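/- Let $p\ge 1$ and let $(a_n)_{n\ge1}$, $(b_n)_{n\ge1}$ be real sequences with $a_n>0$, $a_{n+p}=a_n$, $b_{n+p}=b_n$; put $a_0:=a_p$. Let $p_n$ be the orthonormal polynomials defined by $p_{-1}=0$, $p_0=1$ and $$x\,p_n(x)=a_{n+1}p_{n+1}(x)+b_{n+1}p_n(x)+a_np_{n-1}(x).$$ Let $$A_k(z)=\frac1{a_{k+1}}\begin{pmatrix} z-b_{k+1} & -a_k\\ a_{k+1} & 0\end{pmatrix},\qquad T_p=A_{p-1}\cdots A_0,\qquad \Delta=\operatorname{Tr}T_p,$$ and list the solutions of $\Delta=2$ and of $\Delta=-2$ with multiplicity in nondecreasing order as $\alpha_1<\beta_1\le\alpha_2<\beta_2\le\dots\le\alpha_p<\beta_p$. The bands are the intervals $[\alpha_j,\beta_j]$, $j=1,\dots,p$. Let $dk$ be the (logarithmic) equilibrium measure of the union of the bands and $k(x)=\int_{\alpha_1}^x dk$. Let $N^{(n,j)}$ be the number of zeros of $p_n$ in band $j$, and $x_1^{(n,j)}<\dots<x_{N^{(n,j)}}^{(n,j)}$ these zeros. Then the following hold, whether all bands are taken closed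 (as above) or all are replaced by their interiors $(\alpha_j,\beta_j)$. 1. For each integer $b\ge 0$ and each $j\in\{1,\dots,p\}$ there is an integer $D_{b,j}$ such that, for all sufficiently large $m$, the number $N^{(mp+b-1,\,j)}$ is either $m-D_{b,j}$ or $m-D_{b,j}+1$. 2. $\displaystyle\sup_{n\ge0,\ 1\le j\le p}\Bigl|\frac np-N^{(n,j)}\Bigr|<\infty.$ 3. The zeros have clock spacing in each band: $$\sup_{1\le j\le p,\ 1\le\ell\le N^{(n,j)}-1} n\,\Bigl|k\bigl(x_{\ell+1}^{(n,j)}\bigr)-k\bigl(x_\ell^{(n,j)}\bigr)-\frac1n\Bigr|\to0\quad\text{as }n\to\infty,$$ and there is a constant $K$, independent of $n$, $j$ and $\ell$, such that for all $n\ge1$, all $j$ and all $1\le\ell\le N^{(n,j)}-1$, $$\Bigl|k\bigl(x_{\ell+1}^{(n,j)}\bigr)-k\bigl(x_\ell^{(n,j)}\bigr)-\frac1n\Bigr|\le\frac K{n^2}.$$ -/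

import Mathlib

noncomputable section

namespace PeriodicJacobi

open Polynomial

/-- The orthonormal polynomials of the Jacobi parameters `a 1, a 2, …` and `b 1, b 2, …`,
normalized by `p_0 = 1`: `x p_n = a_{n+1} p_{n+1} + b_{n+1} p_n + a_n p_{n-1}`, `p_{-1} = 0`. -/
def orthoPoly (a b : ℕ → ℝ) : ℕ → ℝ[X]
  | 0 => 1
  | 1 => C (a 1)⁻¹ * (X - C (b 1))
  | n + 2 => C (a (n + 2))⁻¹ *
      ((X - C (b (n + 2))) * orthoPoly a b (n + 1) - C (a (n + 1)) * orthoPoly a b n)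

/-- The one-step matrix `A_k(z) = (1 / a_{k+1}) [[z - b_{k+1}, -a_k], [a_{k+1}, 0]]`. -/
def stepMatrix (a b : ℕ → ℝ) (k : ℕ) : Matrix (Fin 2) (Fin 2) ℝ[X] :=
  C (a (k + 1))⁻¹ • !![X - C (b (k + 1)), -C (a k); C (a (k + 1)), 0]

/-- The transfer matrix `T_n = A_{n-1} ⋯ A_0`. -/
def transferMatrix (a b : ℕ → ℝ) : ℕ → Matrix (Fin 2) (Fin 2) ℝ[X]
  | 0 => 1
  | n + 1 => stepMatrix a b n * transferMatrix a b n

/-- The discriminant `Δ = Tr T_p`, a real polynomial of degree `p`. -/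
def discriminant (a b : ℕ → ℝ) (p : ℕ) : ℝ[X] :=
  (transferMatrix a b p).trace

/-- The solutions of `Δ = 2` and of `Δ = -2`, repeated according to multiplicity, in
nondecreasing order: `α_1, β_1, α_2, β_2, …, α_p, β_p`. -/
def bandEdges (a b : ℕ → ℝ) (p : ℕ) : List ℝ :=
  ((discriminant a b p - 2) * (discriminant a b p + 2)).roots.sort (· ≤ ·)

/-- The left edge of the band with index `j`, where bands are indexed from `0` to `p - 1`. -/
def bandLeft (a b : ℕ → ℝ) (p j : ℕ) : ℝ :=
  (bandEdges a b p).getD (2 * j) 0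

/-- The right edge of the band with index `j`, where bands are indexed from `0` to `p - 1`. -/
def bandRight (a b : ℕ → ℝ) (p j : ℕ) : ℝ :=
  (bandEdges a b p).getD (2 * j + 1) 0

/-- The union of the closed bands. -/
def bands (a b : ℕ → ℝ) (p : ℕ) : Set ℝ :=
  ⋃ j : Fin p, Set.Icc (bandLeft a b p j) (bandRight a b p j)

/-- The logarithmic kernel `log (1 / |x - y|)`, with the value `⊤` for `x = y`. -/
def logKernel (x y : ℝ) : EReal :=
  -ENNReal.log (edist x y)

open MeasureTheory in
/-- The logarithmic energy `∬ log (1 / |x - y|) dμ(x) dμ(y)`, as the integral of the positive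
part minus the integral of the negative part. The latter is finite when `μ` is a finite measure
that lives on a bounded set, the only case that is used. -/
def logEnergy (μ : Measure ℝ) : EReal :=
  ((∫⁻ x, ∫⁻ y, (logKernel x y).toENNReal ∂μ ∂μ : ENNReal) : EReal) -
    ((∫⁻ x, ∫⁻ y, (-logKernel x y).toENNReal ∂μ ∂μ : ENNReal) : EReal)

open MeasureTheory in
/-- `μ` is an equilibrium measure of `B`: a probability measure on `B` of finite logarithmic
energy, which is the least among all probability measures on `B`. -/
structure IsEquilibriumMeasure (B : Set ℝ) (μ : Measure ℝ) : Prop where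
  isProbabilityMeasure : IsProbabilityMeasure μ
  measure_compl : μ Bᶜ = 0
  energy_lt_top : logEnergy μ < ⊤
  energy_le : ∀ ν : Measure ℝ, IsProbabilityMeasure ν → ν Bᶜ = 0 → logEnergy μ ≤ logEnergy ν

open MeasureTheory in
open Classical in
/-- The equilibrium measure of `B` (it exists and is unique for a finite union of nondegenerate
compact intervals; the value is `0` if there is none). -/
def equilibriumMeasure (B : Set ℝ) : Measure ℝ :=
  if h : ∃ μ : Measure ℝ, IsEquilibriumMeasure B μ then h.choose else 0

/-- `k(x) = ∫_{α_1}^x dk`, where `dk` is the equilibrium measure of the union of the bands. -/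
def equilibriumCDF (a b : ℕ → ℝ) (p : ℕ) (x : ℝ) : ℝ :=
  (equilibriumMeasure (bands a b p)).real (Set.Icc (bandLeft a b p 0) x)

/-- The zeros of `p_n` in a set `I`. -/
def zerosIn (a b : ℕ → ℝ) (n : ℕ) (I : Set ℝ) : Set ℝ :=
  {x | x ∈ I ∧ (orthoPoly a b n).eval x = 0}

/-- `x < y` are consecutive elements of `S`. -/
def Consecutive (S : Set ℝ) (x y : ℝ) : Prop :=
  x ∈ S ∧ y ∈ S ∧ x < y ∧ ∀ z ∈ S, ¬(x < z ∧ z < y)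

end PeriodicJacobi

end

/-!
On a residue class `n = r + m p` the polynomials `q_m = p_{r + m p}` satisfy
`q_{m+2} = Δ q_{m+1} - q_m`, by Cayley–Hamilton for the transfer matrix over one period
(`orthoPoly_add_two_periods`). Where `Δ(x) = 2 cos θ` this is the recurrence of `sin (m θ)` and
`cos (m θ)`, so on a band, parametrized by `x = Y(θ)` with `θ ∈ [0, π]`,
`sin θ · q_m(x) = R(θ) sin (m θ + φ(θ))` with `R ≠ 0` inside the band, and inside the band the zeros
of `q_m` are the points with `m θ + φ(θ) ∈ π ℤ`.

Everything rests on `φ` being Lipschitz on all of `[0, π]`, edges included. The amplitude and phase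
come from one complex-valued function `Ψ(θ)` without zeros inside the band, and
`φ' = Im (Ψ' / Ψ)`. The function `Y` is real analytic up to the edges
(`IsBandParam.exists_analyticAt`): at an edge, `Δ ∓ 2` has a simple or a double zero, and
near it `x` is an analytic function of `2 cos θ` in the first case and of `2 sin θ` in the second.
Hence `Ψ` is analytic up to the edges, and a zero of `Ψ` of order `k` at an edge `θ₀` contributes to
the logarithmic derivative only the real summand `k / (θ - θ₀)` (`exists_bound_im_logDeriv`). So
`m θ + φ(θ)` is strictly increasing for large `m`. For such `m`, the number of zeros in the band is
`m` plus a constant, and consecutive zeros are `π / m + O(1 / m²)` apart in the angle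
(`IsFloquetSequence.exists_ncard_Icc`, `IsFloquetSequence.exists_spacing`).

That the list of band edges behaves as expected (`isBand_bandLeft_bandRight`) is deduced from
two facts about `Δ`: for `|c| ≤ 2` all roots of `Δ - c` are real, because a nonreal root would be
a nonreal eigenvalue of a Hermitian Floquet problem, and then Laguerre's inequality
shows that critical points with `|Δ| ≤ 2` are nondegenerate and lie on `|Δ| = 2`.

Finally, the equilibrium measure of the bands is the pullback under `Δ` of the arcsine measure of
`[-2, 2]`, that is, each band carries the image under `Y` of the normalized Lebesgue measure
on `[0, π]`, with mass `1 / p` (`equilibriumMeasure_bands`). Its logarithmic potential is constant on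
the bands, because `Δ(x) - 2 cos θ` is the product of the `x - Y_j(θ)` up to a constant factor and
the arcsine measure has vanishing potential on `[-2, 2]`. A probability measure with constant
potential is the unique minimizer of the energy, by the positive definiteness of the logarithmic
energy on differences of probability measures (`mutualEnergy_posDef`), which follows from that of
the Gaussian kernels by Frullani's formula. Therefore `p π k = ± θ + const` on each band
(`equilibriumCDF_sub`), and the spacing `π / m + O(1 / m²)` of the angles is a spacing
`1 / n + O(1 / n²)` of `k`.
-/

noncomputable section

namespace PeriodicJacobi

open Polynomial

/-! ### Transfer matrices and orthonormal polynomials -/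

section Algebra

variable {a b : ℕ → ℝ} {p : ℕ}

theorem orthoPoly_succ_succ (ha : ∀ n, 0 < a n) (n : ℕ) :
    C (a (n + 2)) * orthoPoly a b (n + 2) =
      (X - C (b (n + 2))) * orthoPoly a b (n + 1) - C (a (n + 1)) * orthoPoly a b n := by
  rw [orthoPoly, ← mul_assoc, ← C_mul, mul_inv_cancel₀ (ha _).ne', C_1, one_mul]

theorem stepMatrix_add_period (hap : ∀ n, a (n + p) = a n) (hbp : ∀ n, b (n + p) = b n) (k : ℕ) :
    stepMatrix a b (k + p) = stepMatrix a b k := by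
  have h1 : k + p + 1 = (k + 1) + p := by ring
  simp only [stepMatrix, h1, hap, hbp]

theorem transferMatrix_add_period (hap : ∀ n, a (n + p) = a n) (hbp : ∀ n, b (n + p) = b n)
    (n : ℕ) : transferMatrix a b (n + p) = transferMatrix a b n * transferMatrix a b p := by
  induction n with
  | zero => simp [transferMatrix]
  | succ n ih =>
    rw [show n + 1 + p = (n + p) + 1 by ring, transferMatrix, ih, stepMatrix_add_period hap hbp,
      transferMatrix, Matrix.mul_assoc]

theorem C_mul_det_transferMatrix (ha : ∀ n, 0 < a n) (n : ℕ) :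
    C (a n) * (transferMatrix a b n).det = C (a 0) := by
  induction n with
  | zero => simp [transferMatrix]
  | succ n ih =>
    have h : (C (a (n + 1)) : ℝ[X]) * C (a (n + 1))⁻¹ = 1 := by
      rw [← C_mul, mul_inv_cancel₀ (ha _).ne', C_1]
    rw [transferMatrix, Matrix.det_mul, ← ih, stepMatrix, Matrix.det_smul, Matrix.det_fin_two_of,
      Fintype.card_fin]
    generalize (transferMatrix a b n).det = d
    linear_combination (C (a n) * d * (1 + C (a (n + 1)) * C (a (n + 1))⁻¹)) * h

theorem det_transferMatrix_period (ha : ∀ n, 0 < a n) (hap : ∀ n, a (n + p) = a n) :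
    (transferMatrix a b p).det = 1 := by
  have h := C_mul_det_transferMatrix (b := b) ha p
  have h0 : a p = a 0 := by simpa using hap 0
  rw [h0] at h
  have hc : (C (a 0) : ℝ[X]) ≠ 0 := by simpa using (ha 0).ne'
  exact mul_left_cancel₀ hc (by rw [h, mul_one])

theorem transferMatrix_succ_apply_zero (n : ℕ) (j : Fin 2) :
    transferMatrix a b (n + 1) 0 j = C (a (n + 1))⁻¹ *
      ((X - C (b (n + 1))) * transferMatrix a b n 0 j - C (a n) * transferMatrix a b n 1 j) := by
  simp [transferMatrix, stepMatrix, Matrix.mul_apply]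
  ring

theorem transferMatrix_succ_apply_one (ha : ∀ n, 0 < a n) (n : ℕ) (j : Fin 2) :
    transferMatrix a b (n + 1) 1 j = transferMatrix a b n 0 j := by
  have h : (C (a (n + 1))⁻¹ : ℝ[X]) * C (a (n + 1)) = 1 := by
    rw [← C_mul, inv_mul_cancel₀ (ha _).ne', C_1]
  simp only [transferMatrix, stepMatrix, Matrix.mul_apply, Fin.sum_univ_two, Matrix.smul_apply,
    Matrix.of_apply, smul_eq_mul, Matrix.cons_val_zero, Matrix.cons_val_one, Matrix.cons_val',
    Matrix.cons_val_fin_one]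
  linear_combination (transferMatrix a b n 0 j) * h

/-- The orthonormal polynomials are the upper left entries of the transfer matrices. -/
theorem transferMatrix_apply_zero_zero (ha : ∀ n, 0 < a n) (n : ℕ) :
    transferMatrix a b n 0 0 = orthoPoly a b n := by
  induction n using Nat.twoStepInduction with
  | zero => simp [transferMatrix, orthoPoly]
  | one => rw [transferMatrix_succ_apply_zero]; simp [transferMatrix, orthoPoly]
  | more n h0 h1 =>
    rw [transferMatrix_succ_apply_zero, transferMatrix_succ_apply_one ha, h0, h1, orthoPoly]

/-- Cayley–Hamilton for the transfer matrix over one period, read off in the upper left entry. -/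
theorem orthoPoly_add_two_periods (ha : ∀ n, 0 < a n) (hap : ∀ n, a (n + p) = a n)
    (hbp : ∀ n, b (n + p) = b n) (n : ℕ) :
    orthoPoly a b (n + p + p) =
      discriminant a b p * orthoPoly a b (n + p) - orthoPoly a b n := by
  have hd := det_transferMatrix_period (b := b) ha hap
  simp only [← transferMatrix_apply_zero_zero ha, discriminant, transferMatrix_add_period hap hbp,
    Matrix.trace_fin_two, Matrix.mul_apply, Fin.sum_univ_two]
  rw [Matrix.det_fin_two] at hd
  linear_combination (-transferMatrix a b n 0 0) * hd

theorem natDegree_transferMatrix_zero_le (ha : ∀ n, 0 < a n) (n : ℕ) (j : Fin 2) :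
    (transferMatrix a b n 0 j).natDegree ≤ n ∧ (transferMatrix a b (n + 1) 1 j).natDegree ≤ n := by
  rw [transferMatrix_succ_apply_one ha, and_self]
  have key : ∀ (c d e f : ℝ) (q r : ℝ[X]) (n : ℕ), q.natDegree ≤ n → r.natDegree ≤ n + 1 →
      (C c * ((X - C d) * q - C e * r)).natDegree ≤ n + 1 := by
    intro c d e f q r n hq hr
    refine (natDegree_C_mul_le _ _).trans ((natDegree_sub_le _ _).trans (max_le ?_ ?_))
    · refine natDegree_mul_le.trans ?_
      rw [natDegree_X_sub_C]; omega
    · exact (natDegree_C_mul_le _ _).trans hr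
  have hone : ∀ i : Fin 2, ((1 : Matrix (Fin 2) (Fin 2) ℝ[X]) i j).natDegree = 0 := by
    intro i
    rw [Matrix.one_apply]
    split_ifs <;> simp
  induction n using Nat.twoStepInduction with
  | zero => exact (hone 0).le
  | one =>
    rw [transferMatrix_succ_apply_zero]
    exact key _ _ _ 0 _ _ 0 (hone 0).le ((hone 1).le.trans zero_le_one)
  | more n h0 h1 =>
    rw [transferMatrix_succ_apply_zero, transferMatrix_succ_apply_one ha]
    exact key _ _ _ 0 _ _ _ h1 (h0.trans (by omega))

theorem coeff_orthoPoly_self_pos (ha : ∀ n, 0 < a n) (n : ℕ) : 0 < (orthoPoly a b n).coeff n := by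
  have hle : ∀ n, (orthoPoly a b n).natDegree ≤ n := fun n => by
    rw [← transferMatrix_apply_zero_zero ha]
    exact (natDegree_transferMatrix_zero_le ha n 0).1
  induction n using Nat.twoStepInduction with
  | zero => simp [orthoPoly]
  | one => simp [orthoPoly, coeff_X, ha]
  | more n h0 h1 =>
    have h2 : (orthoPoly a b (n + 1)).coeff (n + 2) = 0 :=
      coeff_eq_zero_of_natDegree_lt ((hle _).trans_lt (by omega))
    have h3 : (orthoPoly a b n).coeff (n + 2) = 0 :=
      coeff_eq_zero_of_natDegree_lt ((hle _).trans_lt (by omega))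
    simp only [orthoPoly, coeff_C_mul, coeff_sub, sub_mul, coeff_X_mul, h2, h3]
    simpa using mul_pos (inv_pos.2 (ha (n + 2))) h1

theorem natDegree_discriminant_le (ha : ∀ n, 0 < a n) (hp : 1 ≤ p) :
    (discriminant a b p).natDegree ≤ p := by
  obtain ⟨q, rfl⟩ : ∃ q, p = q + 1 := ⟨p - 1, by omega⟩
  rw [discriminant, Matrix.trace_fin_two]
  refine (natDegree_add_le _ _).trans (max_le (natDegree_transferMatrix_zero_le ha _ _).1
    ((natDegree_transferMatrix_zero_le ha _ _).2.trans (by omega)))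

theorem coeff_discriminant_pos (ha : ∀ n, 0 < a n) (hp : 1 ≤ p) :
    0 < (discriminant a b p).coeff p := by
  obtain ⟨q, rfl⟩ : ∃ q, p = q + 1 := ⟨p - 1, by omega⟩
  rw [discriminant, Matrix.trace_fin_two, coeff_add, transferMatrix_apply_zero_zero ha,
    coeff_eq_zero_of_natDegree_lt (p := transferMatrix a b (q + 1) 1 1)
      ((natDegree_transferMatrix_zero_le ha q 1).2.trans_lt (by omega)), add_zero]
  exact coeff_orthoPoly_self_pos ha _

theorem natDegree_discriminant (ha : ∀ n, 0 < a n) (hp : 1 ≤ p) :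
    (discriminant a b p).natDegree = p :=
  le_antisymm (natDegree_discriminant_le ha hp)
    (le_natDegree_of_ne_zero (coeff_discriminant_pos ha hp).ne')

/-- The confluent Christoffel–Darboux formula. -/
theorem christoffelDarboux (ha : ∀ n, 0 < a n) (x : ℝ) (n : ℕ) :
    a (n + 1) * ((orthoPoly a b (n + 1)).derivative.eval x * (orthoPoly a b n).eval x -
      (orthoPoly a b n).derivative.eval x * (orthoPoly a b (n + 1)).eval x) =
      ∑ k ∈ Finset.range (n + 1), (orthoPoly a b k).eval x ^ 2 := by
  induction n with
  | zero =>
    simp [orthoPoly, (ha 1).ne']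
  | succ n ih =>
    have h := orthoPoly_succ_succ (b := b) ha n
    have h1 := congrArg (eval x) h
    have h2 := congrArg (fun q => eval x (derivative q)) h
    simp only [derivative_mul, derivative_sub, derivative_X, derivative_C, eval_add, eval_sub,
      eval_mul, eval_C, eval_X, eval_one, eval_zero] at h1 h2
    rw [Finset.sum_range_succ, ← ih]
    linear_combination (orthoPoly a b (n + 1)).eval x * h2 -
      (orthoPoly a b (n + 1)).derivative.eval x * h1

theorem sum_sq_orthoPoly_pos (x : ℝ) (n : ℕ) :
    0 < ∑ k ∈ Finset.range (n + 1), (orthoPoly a b k).eval x ^ 2 := by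
  rw [Finset.sum_range_succ']
  have : 0 ≤ ∑ k ∈ Finset.range n, (orthoPoly a b (k + 1)).eval x ^ 2 :=
    Finset.sum_nonneg fun _ _ => sq_nonneg _
  simp only [orthoPoly, eval_one]
  linarith

theorem orthoPoly_succ_ne_zero_of_eq_zero (ha : ∀ n, 0 < a n) {x : ℝ} {n : ℕ}
    (h : (orthoPoly a b n).eval x = 0) : (orthoPoly a b (n + 1)).eval x ≠ 0 := by
  intro h1
  have := christoffelDarboux (b := b) ha x n
  rw [h, h1] at this
  have := sum_sq_orthoPoly_pos (a := a) (b := b) x n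
  simp_all

/-- If `p_n` and `p_{n+p}` vanish at `x`, then the sequence `p_k(x)` is multiplied by a constant
when `k` increases by a period: it is then a Floquet solution. -/
theorem exists_multiplier (ha : ∀ n, 0 < a n) (hap : ∀ n, a (n + p) = a n)
    (hbp : ∀ n, b (n + p) = b n) {x : ℝ} {n : ℕ}
    (h0 : (orthoPoly a b n).eval x = 0) (h1 : (orthoPoly a b (n + p)).eval x = 0) :
    ∃ c : ℝ, (orthoPoly a b (n + 1 + p)).eval x = c * (orthoPoly a b (n + 1)).eval x ∧
      (discriminant a b p).eval x * c = c ^ 2 + 1 := by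
  have hne := orthoPoly_succ_ne_zero_of_eq_zero ha h0
  set v : ℕ → ℝ := fun k => (orthoPoly a b k).eval x with hv
  set c := v (n + 1 + p) / v (n + 1) with hc
  have hrec : ∀ k, a (k + 2) * v (k + 2) = (x - b (k + 2)) * v (k + 1) - a (k + 1) * v k := by
    intro k
    have := congrArg (eval x) (orthoPoly_succ_succ (b := b) ha k)
    simpa using this
  have hrecp : ∀ k, a (k + 2) * v (k + 2 + p) =
      (x - b (k + 2)) * v (k + 1 + p) - a (k + 1) * v (k + p) := by
    intro k
    have := hrec (k + p)
    rw [show k + p + 2 = k + 2 + p by ring, show k + p + 1 = k + 1 + p by ring] at this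
    rwa [hap, hap, hbp] at this
  have hmul : ∀ k, v (n + k + p) = c * v (n + k) ∧ v (n + k + 1 + p) = c * v (n + k + 1) := by
    intro k
    induction k with
    | zero =>
      refine ⟨?_, ?_⟩
      · simp only [hv, add_zero, h0, h1, mul_zero]
      · simp only [hc, add_zero]; exact (div_mul_cancel₀ _ hne).symm
    | succ k ih =>
      refine ⟨ih.2, mul_left_cancel₀ (ha (n + k + 2)).ne' ?_⟩
      have e1 := hrec (n + k)
      have e2 := hrecp (n + k)
      rw [ih.1, ih.2] at e2
      rw [show n + (k + 1) + 1 = n + k + 2 by ring]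
      linear_combination e2 - c * e1
  refine ⟨c, by simpa using (hmul 0).2, ?_⟩
  have e := congrArg (eval x) (orthoPoly_add_two_periods ha hap hbp (n + 1))
  simp only [eval_sub, eval_mul] at e
  have e1 : v (n + 1 + p) = c * v (n + 1) := by simpa using (hmul 0).2
  have e2 : v (n + 1 + p + p) = c * v (n + 1 + p) := by
    have := (hmul (p)).2
    rwa [show n + p + 1 + p = n + 1 + p + p by ring, show n + p + 1 = n + 1 + p by ring] at this
  change v (n + 1 + p + p) = _ * v (n + 1 + p) - v (n + 1) at e
  rw [e2, e1] at e
  refine mul_right_cancel₀ hne ?_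
  change _ * v (n + 1) = _ * v (n + 1)
  linear_combination -e

/-- In the interior of the bands, `p_n` and `p_{n+p}` have no common zeros. -/
theorem two_le_abs_discriminant_of_common_zero (ha : ∀ n, 0 < a n) (hap : ∀ n, a (n + p) = a n)
    (hbp : ∀ n, b (n + p) = b n) {x : ℝ} {n : ℕ}
    (h0 : (orthoPoly a b n).eval x = 0) (h1 : (orthoPoly a b (n + p)).eval x = 0) :
    2 ≤ |(discriminant a b p).eval x| := by
  obtain ⟨c, -, hc⟩ := exists_multiplier ha hap hbp h0 h1
  by_contra! h
  rw [abs_lt] at h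
  nlinarith [sq_nonneg (c - (discriminant a b p).eval x / 2)]

/-- At a common zero of `p_n` and `p_{n+p}` at which `Δ = 2s`, `s = ±1`, the derivatives satisfy
`p_{n+p}' ≠ s p_n'`: otherwise the Christoffel–Darboux sums up to `n` and `n + p` would agree. -/
theorem derivative_ne_of_common_zero (hp : 1 ≤ p) (ha : ∀ n, 0 < a n)
    (hap : ∀ n, a (n + p) = a n) (hbp : ∀ n, b (n + p) = b n) {x s : ℝ} {n : ℕ}
    (h0 : (orthoPoly a b n).eval x = 0) (h1 : (orthoPoly a b (n + p)).eval x = 0)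
    (hs : s ^ 2 = 1) (hx : (discriminant a b p).eval x = 2 * s) :
    (orthoPoly a b (n + p)).derivative.eval x ≠ s * (orthoPoly a b n).derivative.eval x := by
  obtain ⟨c, hcv, hc⟩ := exists_multiplier ha hap hbp h0 h1
  have hcs : c = s := by
    rw [hx] at hc
    have : (c - s) ^ 2 = 0 := by linear_combination -hc + hs
    have := pow_eq_zero_iff (two_ne_zero) |>.1 this
    linarith
  subst hcs
  intro hd
  have e0 := christoffelDarboux (b := b) ha x n
  have e1 := christoffelDarboux (b := b) ha x (n + p)
  rw [show n + p + 1 = n + 1 + p by ring, hap, hcv, hd, h1] at e1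
  rw [h0] at e0
  have hne := orthoPoly_succ_ne_zero_of_eq_zero ha h0
  have hlt : ∑ k ∈ Finset.range (n + 1), (orthoPoly a b k).eval x ^ 2 <
      ∑ k ∈ Finset.range (n + 1 + p), (orthoPoly a b k).eval x ^ 2 := by
    refine Finset.sum_lt_sum_of_subset (i := n + 1) (Finset.range_mono (by omega)) ?_ ?_ ?_ ?_
    · simp; omega
    · simp
    · positivity
    · intros; positivity
  rw [← e0, ← e1] at hlt
  refine absurd hlt (not_lt.2 (le_of_eq ?_))
  linear_combination (-a (n + 1) * (orthoPoly a b n).derivative.eval x *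
    (orthoPoly a b (n + 1)).eval x) * hs

end Algebra

/-! ### Real roots of the discriminant and Laguerre's inequality -/

section RealRoots

variable {a b : ℕ → ℝ} {p : ℕ}

/-- If `Δ(z) ∈ [-2, 2]` then `z` is real: the matrix `T_p(z)` has an eigenvalue of modulus one, so
there is a Floquet solution of the three-term recurrence with unimodular multiplier, and the sum of
its squared moduli over a period is killed by `Im z`, because the boundary terms cancel. -/
theorem im_eq_zero_of_aeval_discriminant (hp : 1 ≤ p) (ha : ∀ n, 0 < a n)
    (hap : ∀ n, a (n + p) = a n) {z : ℂ} {c : ℝ} (hc : |c| ≤ 2)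
    (hz : aeval z (discriminant a b p) = (c : ℂ)) : z.im = 0 := by
  by_contra him
  set T : ℕ → Matrix (Fin 2) (Fin 2) ℂ := fun n => (aeval z).mapMatrix (transferMatrix a b n)
    with hT
  have hdet : (T p).det = 1 := by
    rw [hT, ← AlgHom.map_det, det_transferMatrix_period ha hap, map_one]
  have htr : (T p).trace = c := by
    rw [← hz, discriminant, Matrix.trace_fin_two, Matrix.trace_fin_two, map_add]; rfl
  have hnn : 0 ≤ 1 - c ^ 2 / 4 := by rw [abs_le] at hc; nlinarith
  -- an eigenvalue of modulus one
  set μ : ℂ := ⟨c / 2, √(1 - c ^ 2 / 4)⟩ with hμ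
  have hsq := Real.mul_self_sqrt hnn
  have hμ1 : Complex.normSq μ = 1 := by
    rw [Complex.normSq_apply]; simp only [hμ]; linarith
  have hμ2 : μ ^ 2 - c * μ + 1 = 0 := by
    apply Complex.ext
    · simp [pow_two, hμ]
      rw [pow_two c] at hsq
      linarith
    · simp [pow_two, hμ]; ring
  have hdet0 : (T p - μ • (1 : Matrix (Fin 2) (Fin 2) ℂ)).det = 0 := by
    rw [Matrix.det_fin_two] at hdet ⊢
    rw [Matrix.trace_fin_two] at htr
    simp
    linear_combination hdet + hμ2 - μ * htr
  obtain ⟨w, hw0, hw⟩ := Matrix.exists_mulVec_eq_zero_iff.2 hdet0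
  rw [Matrix.sub_mulVec, Matrix.smul_mulVec, Matrix.one_mulVec, sub_eq_zero] at hw
  set f : ℕ → ℂ := fun n => (T n).mulVec w 0 with hf
  set g : ℕ → ℂ := fun n => (T n).mulVec w 1 with hg
  have hfg : ∀ n, g (n + 1) = f n := by
    intro n
    simp only [hf, hg, hT, Matrix.mulVec, dotProduct, Fin.sum_univ_two, AlgHom.mapMatrix_apply,
      Matrix.map_apply, transferMatrix_succ_apply_one ha]
  have hrec : ∀ n, (a (n + 1) : ℂ) * f (n + 1) = (z - b (n + 1)) * f n - a n * g n := by
    intro n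
    have hne : (a (n + 1) : ℂ) ≠ 0 := by exact_mod_cast (ha _).ne'
    simp only [hf, hg, hT, Matrix.mulVec, dotProduct, Fin.sum_univ_two, AlgHom.mapMatrix_apply,
      Matrix.map_apply, transferMatrix_succ_apply_zero, map_mul, map_sub, aeval_C, aeval_X]
    simp
    field_simp
    ring
  have hf0 : f 0 = w 0 := by simp [hf, hT, transferMatrix]
  have hg0 : g 0 = w 1 := by simp [hg, hT, transferMatrix]
  have hfp : f p = μ * f 0 := by rw [hf0]; exact congrFun hw 0
  have hgp : g p = μ * g 0 := by rw [hg0]; exact congrFun hw 1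
  set W : ℕ → ℝ := fun n => a n * (f n * (starRingEnd ℂ) (g n)).im with hW
  have hstep : ∀ n, W (n + 1) - W n = z.im * Complex.normSq (f n) := by
    intro n
    have h1 : W (n + 1) = ((a (n + 1) * f (n + 1)) * (starRingEnd ℂ) (f n)).im := by
      simp only [hW, hfg]
      rw [mul_assoc, Complex.im_ofReal_mul]
    rw [h1, hrec]
    simp [hW, Complex.normSq_apply]
    ring
  have hsum : z.im * ∑ n ∈ Finset.range p, Complex.normSq (f n) = 0 := by
    rw [Finset.mul_sum, ← Finset.sum_congr rfl fun n _ => hstep n, Finset.sum_range_sub]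
    have h0 : a p = a 0 := by simpa using hap 0
    have : f p * (starRingEnd ℂ) (g p) = f 0 * (starRingEnd ℂ) (g 0) := by
      rw [hfp, hgp, map_mul, mul_mul_mul_comm, Complex.mul_conj, hμ1]
      simp
    simp only [hW, h0, this, sub_self]
  have hall := (Finset.sum_eq_zero_iff_of_nonneg fun n _ => Complex.normSq_nonneg (f n)).1
    ((mul_eq_zero.1 hsum).resolve_left him)
  have h0 : f 0 = 0 := Complex.normSq_eq_zero.1 (hall 0 (Finset.mem_range.2 hp))
  have hμ0 : μ ≠ 0 := by
    intro h; rw [h, map_zero] at hμ1; exact zero_ne_one hμ1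
  have h1 : g 0 = 0 := by
    have := Complex.normSq_eq_zero.1 (hall (p - 1) (Finset.mem_range.2 (by omega)))
    rw [← hfg, Nat.sub_add_cancel hp, hgp] at this
    exact (mul_eq_zero.1 this).resolve_left hμ0
  refine hw0 (funext fun i => ?_)
  fin_cases i
  · exact hf0 ▸ h0
  · exact hg0 ▸ h1

theorem splits_discriminant_sub_C (hp : 1 ≤ p) (ha : ∀ n, 0 < a n)
    (hap : ∀ n, a (n + p) = a n) {c : ℝ} (hc : |c| ≤ 2) :
    (discriminant a b p - C c).Splits := by
  refine Splits.of_splits_map Complex.ofRealHom (IsAlgClosed.splits _) fun z hz => ?_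
  have h := (mem_roots'.1 hz).2
  rw [IsRoot.def, Polynomial.map_sub, eval_sub, map_C, eval_C, sub_eq_zero, eval_map] at h
  exact ⟨z.re, Complex.ext rfl (im_eq_zero_of_aeval_discriminant hp ha hap hc h).symm⟩

/-- Laguerre's inequality for products of real linear factors. -/
theorem laguerre_multiset (s : Multiset ℝ) (x : ℝ) :
    let f : ℝ[X] := (s.map fun r => X - C r).prod
    0 ≤ f.derivative.eval x ^ 2 - f.eval x * f.derivative.derivative.eval x ∧
    (s ≠ 0 → f.eval x ≠ 0 →
      0 < f.derivative.eval x ^ 2 - f.eval x * f.derivative.derivative.eval x) := by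
  induction s using Multiset.induction_on with
  | empty => simp
  | cons r s ih =>
    simp only [Multiset.map_cons, Multiset.prod_cons] at ih ⊢
    generalize (s.map fun r => X - C r).prod = g at ih ⊢
    have key : ((X - C r) * g).derivative.eval x ^ 2 -
        ((X - C r) * g).eval x * ((X - C r) * g).derivative.derivative.eval x =
        g.eval x ^ 2 + (x - r) ^ 2 * (g.derivative.eval x ^ 2 -
          g.eval x * g.derivative.derivative.eval x) := by
      simp only [derivative_mul, derivative_sub, derivative_X, derivative_C, derivative_add,
        eval_add, eval_sub, eval_mul, eval_X, eval_C, sub_zero, one_mul]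
      ring
    rw [key]
    have h1 := mul_nonneg (sq_nonneg (x - r)) ih.1
    refine ⟨add_nonneg (sq_nonneg _) h1, fun _ hne => ?_⟩
    rw [eval_mul] at hne
    have := sq_pos_of_ne_zero (right_ne_zero_of_mul hne)
    linarith

theorem laguerre {f : ℝ[X]} (hf : f.Splits) (hd : f.natDegree ≠ 0) {x : ℝ} (hx : f.eval x ≠ 0) :
    0 < f.derivative.eval x ^ 2 - f.eval x * f.derivative.derivative.eval x := by
  have h := hf.eq_prod_roots
  have hr : f.roots ≠ 0 := by
    intro h0
    rw [hf.natDegree_eq_card_roots, h0] at hd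
    exact hd rfl
  have hL := (laguerre_multiset f.roots x).2 hr
  set g := (f.roots.map fun r => X - C r).prod with hg
  rw [h] at hx ⊢
  simp only [derivative_C_mul, eval_C_mul] at hx ⊢
  have h1 := hL (right_ne_zero_of_mul hx)
  have h2 := sq_pos_of_ne_zero (left_ne_zero_of_mul hx)
  nlinarith [mul_pos h2 h1]

/-- The critical points of `Δ` with `|Δ| ≤ 2` lie on `|Δ| = 2`, and they are nondegenerate
extrema. -/
theorem discriminant_critical (hp : 1 ≤ p) (ha : ∀ n, 0 < a n)
    (hap : ∀ n, a (n + p) = a n) {x : ℝ} (hx : |(discriminant a b p).eval x| ≤ 2)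
    (hd : (discriminant a b p).derivative.eval x = 0) :
    (discriminant a b p).eval x * (discriminant a b p).derivative.derivative.eval x < 0 ∧
      |(discriminant a b p).eval x| = 2 := by
  set D := discriminant a b p with hD
  have key : ∀ c : ℝ, |c| ≤ 2 → D.eval x ≠ c →
      (D.eval x - c) * D.derivative.derivative.eval x < 0 := by
    intro c hc hne
    have h := laguerre (splits_discriminant_sub_C (b := b) hp ha hap hc)
      (x := x) (by rw [natDegree_sub_C, natDegree_discriminant ha hp]; omega)
      (by rw [eval_sub, eval_C]; exact sub_ne_zero.2 hne)
    rw [derivative_sub, derivative_C, sub_zero, ← hD, hd, eval_sub, eval_C] at h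
    linarith
  have h2 : |D.eval x| = 2 := by
    refine le_antisymm hx (not_lt.1 fun hlt => ?_)
    rw [abs_lt] at hlt
    have h1 := key 2 (by norm_num) hlt.2.ne
    have h2 := key (-2) (by norm_num) hlt.1.ne'
    nlinarith
  refine ⟨?_, h2⟩
  have := key 0 (by norm_num) (by intro h; rw [h, abs_zero] at h2; norm_num at h2)
  rwa [sub_zero] at this

theorem card_roots_discriminant_sub_C (hp : 1 ≤ p) (ha : ∀ n, 0 < a n)
    (hap : ∀ n, a (n + p) = a n) {c : ℝ} (hc : |c| < 2) :
    (discriminant a b p - C c).roots.toFinset.card = p := by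
  have hs := splits_discriminant_sub_C (b := b) hp ha hap hc.le
  have hdeg : (discriminant a b p - C c).natDegree = p := by
    rw [natDegree_sub_C, natDegree_discriminant ha hp]
  have hne : discriminant a b p - C c ≠ 0 := by
    intro h; rw [h, natDegree_zero] at hdeg; omega
  rw [Multiset.toFinset_card_of_nodup, ← hs.natDegree_eq_card_roots, hdeg]
  refine Multiset.nodup_iff_count_le_one.2 fun x => ?_
  rw [count_roots]
  by_contra! h
  have h1 := (one_lt_rootMultiplicity_iff_isRoot hne).1 h
  rw [IsRoot.def, IsRoot.def, derivative_sub, derivative_C, sub_zero, eval_sub, eval_C,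
    sub_eq_zero] at h1
  have := (discriminant_critical hp ha hap (by rw [h1.1]; exact hc.le) h1.2).2
  rw [h1.1] at this
  exact hc.ne this

end RealRoots

/-! ### The spectral bands and the list of their edges -/

open Set Filter Topology

section Bands

variable {a b : ℕ → ℝ} {p : ℕ}

/-- `[α, β]` is a spectral band of the polynomial `D`: it maps `[α, β]` injectively onto `[-2, 2]`,
the interior going to the interior. -/
structure IsBand (D : ℝ[X]) (α β : ℝ) : Prop where
  lt : α < β
  abs_lt : ∀ y ∈ Ioo α β, |D.eval y| < 2
  abs_left : |D.eval α| = 2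
  right : D.eval β = -D.eval α
  injOn : InjOn (fun x => D.eval x) (Icc α β)

theorem IsBand.abs_right {D : ℝ[X]} {α β : ℝ} (h : IsBand D α β) : |D.eval β| = 2 := by
  rw [h.right, abs_neg, h.abs_left]

theorem IsBand.abs_le {D : ℝ[X]} {α β : ℝ} (h : IsBand D α β) {y : ℝ} (hy : y ∈ Icc α β) :
    |D.eval y| ≤ 2 := by
  rcases hy.1.eq_or_lt with rfl | h1
  · exact h.abs_left.le
  rcases hy.2.eq_or_lt with rfl | h2
  · exact h.abs_right.le
  · exact (h.abs_lt y ⟨h1, h2⟩).le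

/-- A continuous function that is unbounded to the left and is less than `2` in absolute value
at `x` has a last point of absolute value `2` before `x`. -/
theorem exists_last_abs_eq_two {f : ℝ → ℝ} (hf : Continuous f)
    (hu : Tendsto (fun x => |f x|) atBot atTop) {x : ℝ} (hx : |f x| < 2) :
    ∃ y < x, |f y| = 2 ∧ ∀ z ∈ Ioc y x, |f z| < 2 := by
  set S := {y | 2 ≤ |f y|} ∩ Iic x with hS
  have hclosed : IsClosed S := (isClosed_le continuous_const hf.abs).inter isClosed_Iic
  have hne : S.Nonempty := by
    obtain ⟨y, h1, h2⟩ := ((hu.eventually_ge_atTop 2).and (eventually_le_atBot x)).exists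
    exact ⟨y, h1, h2⟩
  have hbdd : BddAbove S := ⟨x, fun y hy => hy.2⟩
  have hmem := hclosed.csSup_mem hne hbdd
  have hlt : sSup S < x := by
    refine lt_of_le_of_ne hmem.2 fun h => ?_
    have := hmem.1
    rw [h] at this
    exact absurd hx (not_lt.2 this)
  have hz : ∀ z ∈ Ioc (sSup S) x, |f z| < 2 := by
    intro z hz
    by_contra! h
    exact (le_csSup hbdd ⟨h, hz.2⟩).not_gt hz.1
  refine ⟨sSup S, hlt, le_antisymm ?_ hmem.1, hz⟩
  refine le_of_tendsto (f := fun z => |f z|) (x := 𝓝[>] sSup S)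
    ((hf.abs.tendsto _).mono_left nhdsWithin_le_nhds) ?_
  filter_upwards [Ioc_mem_nhdsGT hlt] with z h using (hz z h).le

theorem tendsto_abs_discriminant (hp : 1 ≤ p) (ha : ∀ n, 0 < a n) {l : Filter ℝ} {g : ℝ → ℝ}
    (hg : Tendsto (fun x => |g x|) l atTop) :
    Tendsto (fun x => |(discriminant a b p).eval (g x)|) l atTop :=
  tendsto_norm_atTop (discriminant a b p) (natDegree_pos_iff_degree_pos.1
    (by rw [natDegree_discriminant (b := b) ha hp]; omega)) hg

theorem derivative_discriminant_ne_zero (hp : 1 ≤ p) (ha : ∀ n, 0 < a n)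
    (hap : ∀ n, a (n + p) = a n) {x : ℝ} (hx : |(discriminant a b p).eval x| < 2) :
    (discriminant a b p).derivative.eval x ≠ 0 := fun h =>
  hx.ne (discriminant_critical hp ha hap hx.le h).2

/-- Every point with `|Δ| < 2` lies in a band. -/
theorem exists_isBand (hp : 1 ≤ p) (ha : ∀ n, 0 < a n) (hap : ∀ n, a (n + p) = a n) {x : ℝ}
    (hx : |(discriminant a b p).eval x| < 2) :
    ∃ α β, x ∈ Ioo α β ∧ IsBand (discriminant a b p) α β := by
  set D := discriminant a b p with hD
  obtain ⟨α, hαx, hα, hαl⟩ := exists_last_abs_eq_two (f := fun x => D.eval x) D.continuous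
    (tendsto_abs_discriminant hp ha tendsto_abs_atBot_atTop) hx
  obtain ⟨β, hβx, hβ, hβl⟩ := exists_last_abs_eq_two (f := fun x => D.eval (-x))
    (D.continuous.comp continuous_neg) (x := -x)
    (tendsto_abs_discriminant hp ha (by simpa using tendsto_abs_atBot_atTop)) (by simpa using hx)
  have hlt : ∀ y ∈ Ioo α (-β), |D.eval y| < 2 := by
    intro y hy
    rcases le_total y x with h | h
    · exact hαl y ⟨hy.1, h⟩
    · have := hβl (-y) ⟨by linarith [hy.2], by linarith⟩
      simpa using this
  have hinj : InjOn (fun x => D.eval x) (Icc α (-β)) := by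
    have key : ∀ y ∈ Icc α (-β), ∀ z ∈ Icc α (-β), y < z → D.eval y ≠ D.eval z := by
      intro y hy z hz hyz h
      obtain ⟨c, hc, h0⟩ := exists_deriv_eq_zero hyz D.continuous.continuousOn h
      rw [Polynomial.deriv] at h0
      exact derivative_discriminant_ne_zero hp ha hap
        (hlt c ⟨hy.1.trans_lt hc.1, hc.2.trans_le hz.2⟩) h0
    intro y hy z hz h
    by_contra hne
    rcases lt_or_gt_of_ne hne with h1 | h1
    · exact key y hy z hz h1 h
    · exact key z hz y hy h1 h.symm
  have hαβ : α < -β := by linarith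
  refine ⟨α, -β, ⟨hαx, by linarith⟩, hαβ, hlt, hα, ?_, hinj⟩
  have hne : D.eval α ≠ D.eval (-β) := fun h =>
    hαβ.ne (hinj (left_mem_Icc.2 hαβ.le) (right_mem_Icc.2 hαβ.le) h)
  rcases abs_eq_abs.1 (hβ.trans hα.symm) with h | h
  · exact absurd h.symm hne
  · exact h

/-- The bands with their edges as functions of the index, before these are identified with
`bandLeft` and `bandRight`. -/
theorem exists_bands (hp : 1 ≤ p) (ha : ∀ n, 0 < a n) (hap : ∀ n, a (n + p) = a n) :
    ∃ α β : Fin p → ℝ, (∀ j, IsBand (discriminant a b p) (α j) (β j)) ∧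
      ∀ i j, i < j → β i ≤ α j := by
  set D := discriminant a b p with hD
  have hcard := card_roots_discriminant_sub_C (b := b) (c := 0) hp ha hap (by norm_num)
  set e := (D - C 0).roots.toFinset.orderEmbOfFin hcard with he
  have hroot : ∀ j, D.eval (e j) = 0 := by
    intro j
    have := Finset.orderEmbOfFin_mem (D - C 0).roots.toFinset hcard j
    rw [Multiset.mem_toFinset, mem_roots'] at this
    have h := this.2
    rwa [IsRoot.def, eval_sub, eval_C, sub_zero] at h
  choose α β hmem hband using fun j => exists_isBand (b := b) hp ha hap (x := e j)
    (by rw [← hD, hroot]; norm_num)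
  refine ⟨α, β, hband, fun i j hij => ?_⟩
  have hlt : e i < e j := e.lt_iff_lt.2 hij
  have h1 : β i ≤ e j := by
    by_contra! h
    refine hlt.ne ((hband i).injOn (Ioo_subset_Icc_self (hmem i))
      ⟨((hmem i).1.trans hlt).le, h.le⟩ ?_)
    exact (hroot i).trans (hroot j).symm
  by_contra! h
  have h2 := (hband j).abs_lt (β i) ⟨h, h1.trans_lt (hmem j).2⟩
  exact h2.ne (hband i).abs_right

theorem card_roots_bandEdges_le (hp : 1 ≤ p) (ha : ∀ n, 0 < a n) :
    ((discriminant a b p - 2) * (discriminant a b p + 2)).roots.card ≤ 2 * p ∧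
      (discriminant a b p - 2) * (discriminant a b p + 2) ≠ 0 := by
  have h1 : (discriminant a b p - 2).natDegree = p := by
    rw [← C_ofNat, natDegree_sub_C, natDegree_discriminant ha hp]
  have h2 : (discriminant a b p + 2).natDegree = p := by
    rw [← C_ofNat, natDegree_add_C, natDegree_discriminant ha hp]
  have h3 : discriminant a b p - 2 ≠ 0 := fun h => by
    rw [h, natDegree_zero] at h1; omega
  have h4 : discriminant a b p + 2 ≠ 0 := fun h => by
    rw [h, natDegree_zero] at h2; omega
  refine ⟨(card_roots' _).trans (natDegree_mul_le.trans (by omega)), mul_ne_zero h3 h4⟩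

/-- Where two bands touch, `Δ² - 4` has a local maximum, hence a multiple root. -/
theorem one_lt_rootMultiplicity_of_isBand (hp : 1 ≤ p) (ha : ∀ n, 0 < a n) {α y β : ℝ}
    (h1 : IsBand (discriminant a b p) α y) (h2 : IsBand (discriminant a b p) y β) :
    1 < ((discriminant a b p - 2) * (discriminant a b p + 2)).rootMultiplicity y := by
  set F := (discriminant a b p - 2) * (discriminant a b p + 2) with hF
  have hF0 : F ≠ 0 := (card_roots_bandEdges_le hp ha).2
  have heval : ∀ x, F.eval x = (discriminant a b p).eval x ^ 2 - 4 := by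
    intro x; simp [hF]; ring
  have hy : F.eval y = 0 := by
    rw [heval, ← sq_abs, h2.abs_left]; norm_num
  refine (one_lt_rootMultiplicity_iff_isRoot hF0).2 ⟨hy, ?_⟩
  have hmax : IsLocalMax (fun x => F.eval x) y := by
    filter_upwards [Ioo_mem_nhds h1.lt h2.lt] with x hx
    have : |(discriminant a b p).eval x| ≤ 2 := by
      rcases le_total x y with h | h
      · exact h1.abs_le ⟨hx.1.le, h⟩
      · exact h2.abs_le ⟨h, hx.2.le⟩
    rw [hy, heval, ← sq_abs]
    nlinarith [abs_nonneg ((discriminant a b p).eval x)]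
  have := hmax.deriv_eq_zero
  rwa [Polynomial.deriv] at this

/-- The sorted list of the roots of `(Δ - 2) (Δ + 2)` consists of the edges of the bands: each edge
is a root, an edge that two bands share is a double root, and these exhaust the degree `2p`. -/
theorem getD_bandEdges (hp : 1 ≤ p) (ha : ∀ n, 0 < a n) {α β : Fin p → ℝ}
    (hband : ∀ j, IsBand (discriminant a b p) (α j) (β j)) (hle : ∀ i j, i < j → β i ≤ α j)
    (j : Fin p) : bandLeft a b p j = α j ∧ bandRight a b p j = β j := by
  set F := (discriminant a b p - 2) * (discriminant a b p + 2) with hF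
  have hF0 : F ≠ 0 := (card_roots_bandEdges_le hp ha).2
  set h : Fin p × Fin 2 → ℝ := fun q => if q.2 = 0 then α q.1 else β q.1 with hh
  set g : Fin (p * 2) → ℝ := fun k => h (finProdFinEquiv.symm k) with hg
  have hαmono : StrictMono α := fun i j hij => (hband i).lt.trans_le (hle i j hij)
  have hβmono : StrictMono β := fun i j hij => (hle i j hij).trans_lt (hband j).lt
  have hαh : ∀ q, α q.1 ≤ h q ∧ h q ≤ β q.1 := by
    intro q
    simp only [hh]
    split_ifs
    · exact ⟨le_rfl, (hband _).lt.le⟩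
    · exact ⟨(hband _).lt.le, le_rfl⟩
  have hmono : Monotone g := by
    intro k l hkl
    obtain ⟨⟨i, e⟩, rfl⟩ := finProdFinEquiv.surjective k
    obtain ⟨⟨i', e'⟩, rfl⟩ := finProdFinEquiv.surjective l
    simp only [hg, Equiv.symm_apply_apply]
    rw [Fin.le_def] at hkl
    simp only [finProdFinEquiv_apply_val] at hkl
    rcases lt_trichotomy i i' with hlt | rfl | hgt
    · exact ((hαh (i, e)).2.trans (hle i i' hlt)).trans (hαh (i', e')).1
    · simp only [hh]
      split_ifs with h1 h2 h2
      · exact le_rfl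
      · exact (hband i).lt.le
      · subst h2; exact absurd (Fin.ext (by simpa using hkl)) h1
      · exact le_rfl
    · rw [Fin.lt_def] at hgt
      omega
  have hms : ((List.ofFn g : List ℝ) : Multiset ℝ) =
      Finset.univ.val.map α + Finset.univ.val.map β := by
    have h1 : ((List.ofFn g : List ℝ) : Multiset ℝ) = Finset.univ.val.map g := by
      rw [Fin.univ_val_map]
    have h2 : ∀ y, (Finset.univ.val.map g).count y =
        (Finset.univ.val.map α + Finset.univ.val.map β).count y := by
      intro y
      have hcount : ∀ {ι : Type} [Fintype ι] (f : ι → ℝ), (Finset.univ.val.map f).count y =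
          ∑ i, if y = f i then 1 else 0 := by
        intro ι _ f
        rw [Multiset.count_map, Finset.sum_boole]
        simp [Finset.card_def]
      rw [Multiset.count_add, hcount, hcount, hcount,
        ← Equiv.sum_comp finProdFinEquiv, Fintype.sum_prod_type, ← Finset.sum_add_distrib]
      refine Finset.sum_congr rfl fun i _ => ?_
      simp only [hg, Equiv.symm_apply_apply, hh, Fin.sum_univ_two, if_true, one_ne_zero, if_false]
    rw [h1]; exact Multiset.ext.2 h2
  have hroots : ((List.ofFn g : List ℝ) : Multiset ℝ) = F.roots := by
    refine Multiset.eq_of_le_of_card_le ?_ ?_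
    · rw [hms, Multiset.le_iff_count]
      intro y
      have hnα : (Finset.univ.val.map α).Nodup := Finset.univ.nodup.map hαmono.injective
      have hnβ : (Finset.univ.val.map β).Nodup := Finset.univ.nodup.map hβmono.injective
      have c1 := Multiset.nodup_iff_count_le_one.1 hnα y
      have c2 := Multiset.nodup_iff_count_le_one.1 hnβ y
      have hroot : ∀ y, |(discriminant a b p).eval y| = 2 → 1 ≤ F.roots.count y := by
        intro y hy
        rw [Multiset.one_le_count_iff_mem, mem_roots hF0, IsRoot.def]
        have : F.eval y = (discriminant a b p).eval y ^ 2 - 4 := by simp [hF]; ring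
        rw [this, ← sq_abs, hy]; norm_num
      rw [Multiset.count_add]
      by_cases m1 : y ∈ Finset.univ.val.map α <;> by_cases m2 : y ∈ Finset.univ.val.map β
      · obtain ⟨i, -, hi⟩ := Multiset.mem_map.1 m1
        obtain ⟨k, -, hk⟩ := Multiset.mem_map.1 m2
        have := one_lt_rootMultiplicity_of_isBand hp ha (hk ▸ hband k) (hi ▸ hband i)
        rw [← hF] at this
        rw [count_roots]
        omega
      · obtain ⟨i, -, hi⟩ := Multiset.mem_map.1 m1
        rw [Multiset.count_eq_zero_of_notMem m2]
        have := hroot y (hi ▸ (hband i).abs_left)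
        omega
      · obtain ⟨i, -, hi⟩ := Multiset.mem_map.1 m2
        rw [Multiset.count_eq_zero_of_notMem m1]
        have := hroot y (hi ▸ (hband i).abs_right)
        omega
      · rw [Multiset.count_eq_zero_of_notMem m1, Multiset.count_eq_zero_of_notMem m2]
        exact Nat.zero_le _
    · rw [Multiset.coe_card, List.length_ofFn, mul_comm]
      exact (card_roots_bandEdges_le hp ha).1
  have hedges : bandEdges a b p = List.ofFn g := by
    refine List.Perm.eq_of_pairwise (le := (· ≤ ·)) (fun _ _ _ _ h1 h2 => le_antisymm h1 h2)
      (Multiset.pairwise_sort _ _) (List.sortedLE_ofFn_iff.2 hmono).pairwise ?_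
    refine Multiset.coe_eq_coe.1 ?_
    rw [bandEdges, Multiset.sort_eq, hroots]
  have hget : ∀ e : Fin 2, (bandEdges a b p).getD (2 * j + e) 0 = h (j, e) := by
    intro e
    have hlt : 2 * (j : ℕ) + e < (bandEdges a b p).length := by
      rw [hedges, List.length_ofFn]; omega
    rw [List.getD_eq_getElem _ _ hlt]
    simp only [hedges, List.getElem_ofFn, hg]
    congr 1
    rw [Equiv.symm_apply_eq]
    ext
    simp [finProdFinEquiv_apply_val]
    ring
  have h0 := hget 0
  have h1 := hget 1
  simp only [hh, if_true, Fin.val_zero, add_zero, Fin.val_one] at h0 h1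
  exact ⟨h0, h1⟩

theorem isBand_bandLeft_bandRight (hp : 1 ≤ p) (ha : ∀ n, 0 < a n) (hap : ∀ n, a (n + p) = a n)
    (j : Fin p) : IsBand (discriminant a b p) (bandLeft a b p j) (bandRight a b p j) := by
  obtain ⟨α, β, hband, hle⟩ := exists_bands (b := b) hp ha hap
  obtain ⟨h1, h2⟩ := getD_bandEdges hp ha hband hle j
  rw [h1, h2]
  exact hband j

theorem bandRight_le_bandLeft (hp : 1 ≤ p) (ha : ∀ n, 0 < a n) (hap : ∀ n, a (n + p) = a n)
    {i j : Fin p} (hij : i < j) : bandRight a b p i ≤ bandLeft a b p j := by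
  obtain ⟨α, β, hband, hle⟩ := exists_bands (b := b) hp ha hap
  rw [(getD_bandEdges hp ha hband hle i).2, (getD_bandEdges hp ha hband hle j).1]
  exact hle i j hij

end Bands

/-! ### Parametrization of a band by the angle -/

section Parametrization

/-- `Y` parametrizes the band `[α, β]` of `D` by the angle `θ`, where `D = 2 cos θ`. -/
structure IsBandParam (D : ℝ[X]) (α β : ℝ) (Y : ℝ → ℝ) : Prop where
  isBand : IsBand D α β
  continuous : Continuous Y
  mem : ∀ θ, Y θ ∈ Icc α β
  eval_eq : ∀ θ, D.eval (Y θ) = 2 * Real.cos θ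

variable {D : ℝ[X]} {α β : ℝ} {Y : ℝ → ℝ}

theorem IsBand.exists_param (h : IsBand D α β) : ∃ Y, IsBandParam D α β Y := by
  have hmaps : ∀ x : Icc α β, D.eval (x : ℝ) ∈ Icc (-2 : ℝ) 2 := fun x => _root_.abs_le.1 (h.abs_le x.2)
  have hsurj : Icc (-2 : ℝ) 2 ⊆ (fun x => D.eval x) '' Icc α β := by
    have hcont : ContinuousOn (fun x => D.eval x) (Icc α β) := D.continuous.continuousOn
    rcases (abs_eq (by norm_num)).1 h.abs_left with h1 | h1
    · have := intermediate_value_Icc' h.lt.le hcont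
      rwa [h.right, h1] at this
    · have := intermediate_value_Icc h.lt.le hcont
      rwa [h.right, h1, neg_neg] at this
  let e : Icc α β ≃ Icc (-2 : ℝ) 2 := Equiv.ofBijective (fun x => ⟨D.eval (x : ℝ), hmaps x⟩) <| by
    refine ⟨fun x y hxy => Subtype.ext (h.injOn x.2 y.2 (congrArg Subtype.val hxy)), fun c => ?_⟩
    obtain ⟨x, hx, hc⟩ := hsurj c.2
    exact ⟨⟨x, hx⟩, Subtype.ext hc⟩
  have he : Continuous e := (D.continuous.comp continuous_subtype_val).subtype_mk _
  let f := he.homeoOfEquivCompactToT2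
  have hcos : ∀ θ : ℝ, 2 * Real.cos θ ∈ Icc (-2 : ℝ) 2 := fun θ =>
    ⟨by linarith [Real.neg_one_le_cos θ], by linarith [Real.cos_le_one θ]⟩
  refine ⟨fun θ => f.symm ⟨2 * Real.cos θ, hcos θ⟩, h, ?_, fun θ => (f.symm _).2, fun θ => ?_⟩
  · exact continuous_subtype_val.comp (f.symm.continuous.comp
      ((continuous_const.mul Real.continuous_cos).subtype_mk _))
  · exact congrArg Subtype.val (f.apply_symm_apply ⟨2 * Real.cos θ, hcos θ⟩)

namespace IsBandParam

variable (hY : IsBandParam D α β Y)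
include hY

theorem injOn : InjOn Y (Icc 0 Real.pi) := by
  intro x hx y hy h
  refine Real.injOn_cos hx hy ?_
  have := hY.eval_eq x
  rw [h, hY.eval_eq] at this
  linarith

theorem exists_eq {y : ℝ} (hy : y ∈ Icc α β) : ∃ θ ∈ Icc 0 Real.pi, Y θ = y := by
  have h := abs_le.1 (hY.isBand.abs_le hy)
  refine ⟨Real.arccos (D.eval y / 2), ⟨Real.arccos_nonneg _, Real.arccos_le_pi _⟩,
    hY.isBand.injOn (hY.mem _) hy ?_⟩
  change D.eval _ = D.eval _
  rw [hY.eval_eq, Real.cos_arccos (by linarith) (by linarith)]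
  ring

theorem mem_Ioo_iff {θ : ℝ} (hθ : θ ∈ Icc 0 Real.pi) : Y θ ∈ Ioo α β ↔ θ ∈ Ioo 0 Real.pi := by
  have hev := hY.eval_eq θ
  constructor
  · intro h
    have h1 := abs_lt.1 (hY.isBand.abs_lt _ h)
    rw [hev] at h1
    refine ⟨lt_of_le_of_ne hθ.1 ?_, lt_of_le_of_ne hθ.2 ?_⟩
    · rintro rfl; rw [Real.cos_zero] at h1; linarith
    · rintro rfl; rw [Real.cos_pi] at h1; linarith
  · intro h
    have hs := Real.sin_pos_of_mem_Ioo h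
    have hne : |D.eval (Y θ)| ≠ 2 := by
      rw [hev, Ne, abs_eq (by norm_num)]
      have := Real.sin_sq_add_cos_sq θ
      rintro (h | h)
      · have : Real.cos θ = 1 := by linarith
        nlinarith
      · have : Real.cos θ = -1 := by linarith
        nlinarith
    refine ⟨lt_of_le_of_ne (hY.mem θ).1 fun h => hne ?_, lt_of_le_of_ne (hY.mem θ).2 fun h => hne ?_⟩
    · rw [← h]; exact hY.isBand.abs_left
    · rw [h]; exact hY.isBand.abs_right

theorem strictMonoOn_or_strictAntiOn :
    StrictMonoOn Y (Icc 0 Real.pi) ∨ StrictAntiOn Y (Icc 0 Real.pi) :=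
  hY.continuous.continuousOn.strictMonoOn_of_injOn_Icc' Real.pi_pos.le hY.injOn

/-- The parametrization of a band is real analytic up to both edges of the band: at an edge with
`D' ≠ 0`, and in the interior, it is the composition of `2 cos θ` with a local inverse of `D`, and
at an edge `x₀` with `D' = 0`, it is the composition of `± 2 sin θ` with a local inverse of
an analytic square root of `4 - D²`. -/
theorem exists_analyticAt
    (hcrit : ∀ x, |D.eval x| ≤ 2 → D.derivative.eval x = 0 →
      D.eval x * D.derivative.derivative.eval x < 0 ∧ |D.eval x| = 2)
    (θ₀ : ℝ) :
    ∃ g : ℝ → ℝ, AnalyticAt ℝ g θ₀ ∧ ∀ᶠ θ in 𝓝[Icc 0 Real.pi] θ₀, g θ = Y θ := by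
  set x₀ := Y θ₀ with hx₀
  have hpoly : ∀ (q : ℝ[X]), AnalyticAt ℝ (fun x => q.eval x) x₀ := fun q => by
    simpa using (analyticAt_id (𝕜 := ℝ) (z := x₀)).aeval_polynomial q
  by_cases hd : D.derivative.eval x₀ = 0
  · obtain ⟨hneg, habs⟩ := hcrit x₀ (hY.isBand.abs_le (hY.mem θ₀)) hd
    have hD0 : D.eval x₀ ^ 2 = 4 := by rw [← sq_abs, habs]; norm_num
    -- factor `4 - D²` at the edge
    obtain ⟨H, hH⟩ : (X - C x₀) ^ 2 ∣ (4 - D ^ 2 : ℝ[X]) := by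
      by_cases h0 : (4 - D ^ 2 : ℝ[X]) = 0
      · rw [h0]; exact dvd_zero _
      rw [← le_rootMultiplicity_iff h0]
      refine (one_lt_rootMultiplicity_iff_isRoot h0).2 ⟨?_, ?_⟩
      · simp [hD0]
      · simp [hd, derivative_pow]
    have hHpos : 0 < H.eval x₀ := by
      have h2 := congrArg (fun q => eval x₀ (derivative (derivative q))) hH
      simp [derivative_pow, hd, derivative_mul] at h2
      linarith
    have hHev : ∀ x, 4 - D.eval x ^ 2 = (x - x₀) ^ 2 * H.eval x := fun x => by
      simpa using congrArg (eval x) hH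
    set r : ℝ → ℝ := fun x => (x - x₀) * √(H.eval x) with hr
    have hsqrt : AnalyticAt ℝ (fun x => √(H.eval x)) x₀ :=
      AnalyticAt.fun_comp (g := Real.sqrt) (f := fun x => H.eval x)
        (Real.contDiffAt_sqrt (n := ⊤) hHpos.ne').analyticAt (hpoly H)
    have hran : AnalyticAt ℝ r x₀ := (analyticAt_id.sub analyticAt_const).mul hsqrt
    have hr' : deriv r x₀ ≠ 0 := by
      have h1 : HasDerivAt r (1 * √(H.eval x₀) + (x₀ - x₀) * deriv (fun x => √(H.eval x)) x₀) x₀ :=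
        ((hasDerivAt_id x₀).sub_const x₀).mul hsqrt.differentiableAt.hasDerivAt
      rw [h1.deriv, sub_self, zero_mul, add_zero, one_mul]
      exact (Real.sqrt_pos.2 hHpos).ne'
    have hr0 : r x₀ = 0 := by simp [hr]
    have hinv := hran.analyticAt_localInverse hr'
    have hleft := HasStrictDerivAt.eventually_left_inverse hran.hasStrictDerivAt hr'
    have hsin0 : Real.sin θ₀ = 0 := by
      rw [hY.eval_eq] at hD0
      have := Real.sin_sq_add_cos_sq θ₀
      have : Real.sin θ₀ ^ 2 = 0 := by linarith
      exact pow_eq_zero_iff two_ne_zero |>.1 this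
    -- the sign of the square root is constant, because `x₀` is an edge
    obtain ⟨σ, hσ⟩ : ∃ σ : ℝ, ∀ θ ∈ Icc 0 Real.pi, 0 ≤ H.eval (Y θ) →
        r (Y θ) = σ * (2 * Real.sin θ) := by
      have hsq : ∀ θ, 0 ≤ H.eval (Y θ) → r (Y θ) ^ 2 = (2 * Real.sin θ) ^ 2 := by
        intro θ h
        rw [hr, mul_pow, Real.sq_sqrt h, ← hHev, hY.eval_eq]
        have := Real.sin_sq_add_cos_sq θ
        linarith
      have hedge : x₀ = α ∨ x₀ = β := by
        by_contra! h
        exact (hY.isBand.abs_lt x₀ ⟨lt_of_le_of_ne (hY.mem θ₀).1 h.1.symm,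
          lt_of_le_of_ne (hY.mem θ₀).2 h.2⟩).ne habs
      rcases hedge with h | h
      · refine ⟨1, fun θ hθ hH => ?_⟩
        have hs := Real.sin_nonneg_of_mem_Icc hθ
        have : 0 ≤ r (Y θ) := mul_nonneg (by rw [h]; linarith [(hY.mem θ).1]) (Real.sqrt_nonneg _)
        rw [one_mul]
        exact (sq_eq_sq₀ this (by linarith)).1 (hsq θ hH)
      · refine ⟨-1, fun θ hθ hH => ?_⟩
        have hs := Real.sin_nonneg_of_mem_Icc hθ
        have : r (Y θ) ≤ 0 :=
          mul_nonpos_of_nonpos_of_nonneg (by rw [h]; linarith [(hY.mem θ).2]) (Real.sqrt_nonneg _)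
        have := (sq_eq_sq₀ (neg_nonneg.2 this) (by linarith)).1 ((neg_sq _).trans (hsq θ hH))
        linarith
    refine ⟨fun θ => HasStrictDerivAt.localInverse r (deriv r x₀) x₀ hran.hasStrictDerivAt hr'
      (σ * (2 * Real.sin θ)), ?_, ?_⟩
    · refine AnalyticAt.fun_comp ?_ (analyticAt_const.mul (analyticAt_const.mul Real.analyticAt_sin))
      rw [hsin0, mul_zero, mul_zero, ← hr0]
      exact hinv
    · have hpos : ∀ᶠ x in 𝓝 x₀, 0 < H.eval x := (H.continuous.tendsto x₀).eventually (lt_mem_nhds hHpos)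
      have := (hY.continuous.tendsto θ₀).eventually (hleft.and hpos)
      filter_upwards [mem_nhdsWithin_of_mem_nhds this, self_mem_nhdsWithin] with θ h hθ
      rw [← hσ θ hθ h.2.le]
      exact h.1
  · have hd' : deriv (fun x => D.eval x) x₀ ≠ 0 := by rwa [Polynomial.deriv]
    have hinv := (hpoly D).analyticAt_localInverse hd'
    have hleft := HasStrictDerivAt.eventually_left_inverse (hpoly D).hasStrictDerivAt hd'
    refine ⟨fun θ => HasStrictDerivAt.localInverse (fun x => D.eval x) _ x₀
      (hpoly D).hasStrictDerivAt hd' (2 * Real.cos θ), ?_, ?_⟩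
    · refine AnalyticAt.fun_comp ?_ (analyticAt_const.mul Real.analyticAt_cos)
      rw [← hY.eval_eq]
      exact hinv
    · have := (hY.continuous.tendsto θ₀).eventually hleft
      filter_upwards [mem_nhdsWithin_of_mem_nhds this] with θ h
      rw [← hY.eval_eq]
      exact h

end IsBandParam

end Parametrization

/-! ### Lipschitz continuity of the phase up to the edges -/

section Phase

/-- If a complex function on an interval is, near each point of the compact interval `[0, π]`,
the restriction of an analytic function, and has no zeros in the open interval, then the imaginary
part of its logarithmic derivative is bounded: a zero of order `k` at an endpoint contributes only
the real summand `k / (θ - θ₀)`. -/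
theorem exists_bound_im_logDeriv {Ψ : ℝ → ℂ}
    (hΨ : ∀ θ₀ ∈ Icc 0 Real.pi, ∃ g : ℝ → ℂ, AnalyticAt ℝ g θ₀ ∧
      ∀ᶠ θ in 𝓝[Icc 0 Real.pi] θ₀, g θ = Ψ θ)
    (hne : ∀ θ ∈ Ioo 0 Real.pi, Ψ θ ≠ 0) :
    ∃ C : ℝ, ∀ θ ∈ Ioo 0 Real.pi, |(deriv Ψ θ / Ψ θ).im| ≤ C := by
  have hlocal : ∀ θ₀ ∈ Icc 0 Real.pi, ∃ t ∈ 𝓝[Icc 0 Real.pi] θ₀,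
      ∃ C : ℝ, ∀ θ ∈ t ∩ Ioo 0 Real.pi, |(deriv Ψ θ / Ψ θ).im| ≤ C := by
    intro θ₀ hθ₀
    obtain ⟨g, hg, hgΨ⟩ := hΨ θ₀ hθ₀
    have hgΨ' : ∀ᶠ θ in 𝓝 θ₀, θ ∈ Ioo 0 Real.pi → g θ = Ψ θ :=
      (eventually_nhdsWithin_iff.1 hgΨ).mono fun θ h hθ => h (Ioo_subset_Icc_self hθ)
    have hnz : ¬∀ᶠ θ in 𝓝 θ₀, g θ = 0 := by
      intro h0
      have hcl : θ₀ ∈ closure (Ioo 0 Real.pi) := by rwa [closure_Ioo Real.pi_pos.ne]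
      obtain ⟨θ, ⟨h1, h2⟩, h3⟩ := mem_closure_iff_nhds.1 hcl _ (hgΨ'.and h0)
      exact hne θ h3 (by rw [← h1 h3, h2])
    obtain ⟨k, h, han, hh0, heq⟩ := hg.exists_eventuallyEq_pow_smul_nonzero_iff.2 hnz
    set B : ℝ → ℝ := fun θ => |(deriv h θ / h θ).im| with hB
    have hBcont : ContinuousAt B θ₀ :=
      (Complex.continuous_im.continuousAt.comp (han.deriv.continuousAt.div han.continuousAt hh0)).abs
    have hne' := han.continuousAt.eventually_ne hh0
    have hev : ∀ᶠ θ in 𝓝 θ₀, θ ≠ θ₀ → θ ∈ Ioo 0 Real.pi →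
        |(deriv Ψ θ / Ψ θ).im| ≤ B θ₀ + 1 := by
      filter_upwards [heq.eventually_nhds, hgΨ'.eventually_nhds, hne', han.eventually_analyticAt,
        hBcont.eventually (gt_mem_nhds (lt_add_one (B θ₀)))] with θ h1 h2 h3 h4 h5 hθ hmem
      have hloc : Ψ =ᶠ[𝓝 θ] fun z => (z - θ₀) ^ k • h z := by
        filter_upwards [h1, h2, Ioo_mem_nhds hmem.1 hmem.2] with z hz1 hz2 hz3
        rw [← hz2 hz3, hz1]
      have hsub : θ - θ₀ ≠ 0 := sub_ne_zero.2 hθ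
      have hu : HasDerivAt (fun z : ℝ => (z - θ₀) ^ k) (k * (θ - θ₀) ^ (k - 1) * 1) θ :=
        ((hasDerivAt_id θ).sub_const θ₀).pow k
      have hd := hu.smul h4.differentiableAt.hasDerivAt
      rw [hloc.deriv_eq, hloc.eq_of_nhds]
      change |((deriv ((fun z : ℝ => (z - θ₀) ^ k) • h) θ) / _).im| ≤ _
      rw [hd.deriv]
      have hpow : ((θ - θ₀) ^ k : ℝ) ≠ 0 := pow_ne_zero _ hsub
      have hratio : ((θ - θ₀) ^ k • deriv h θ + (k * (θ - θ₀) ^ (k - 1) * 1) • h θ) /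
          ((θ - θ₀) ^ k • h θ) = deriv h θ / h θ +
            ((k * (θ - θ₀) ^ (k - 1) * 1 / (θ - θ₀) ^ k : ℝ) : ℂ) := by
        have hpc : (((θ - θ₀) ^ k : ℝ) : ℂ) ≠ 0 := Complex.ofReal_ne_zero.2 hpow
        rw [Complex.real_smul, Complex.real_smul, Complex.real_smul, Complex.ofReal_div]
        generalize (((θ - θ₀) ^ k : ℝ) : ℂ) = c at hpc
        generalize ((k * (θ - θ₀) ^ (k - 1) * 1 : ℝ) : ℂ) = d
        field_simp
      rw [hratio, Complex.add_im, Complex.ofReal_im, add_zero]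
      exact h5.le
    refine ⟨_, mem_nhdsWithin_of_mem_nhds hev, max (B θ₀ + 1) |(deriv Ψ θ₀ / Ψ θ₀).im|, ?_⟩
    rintro θ ⟨h1, h2⟩
    by_cases h : θ = θ₀
    · rw [h]; exact le_max_right _ _
    · exact (h1 h h2).trans (le_max_left _ _)
  obtain ⟨C, hC⟩ := isCompact_Icc.induction_on
    (p := fun s => ∃ C : ℝ, ∀ θ ∈ s ∩ Ioo 0 Real.pi, |(deriv Ψ θ / Ψ θ).im| ≤ C)
    ⟨0, by simp⟩ (fun s t hst ⟨C, hC⟩ => ⟨C, fun θ hθ => hC θ ⟨hst hθ.1, hθ.2⟩⟩)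
    (fun s t ⟨C, hC⟩ ⟨C', hC'⟩ => ⟨max C C', fun θ hθ => hθ.1.elim
      (fun h => (hC θ ⟨h, hθ.2⟩).trans (le_max_left _ _))
      (fun h => (hC' θ ⟨h, hθ.2⟩).trans (le_max_right _ _))⟩) hlocal
  exact ⟨C, fun θ hθ => hC θ ⟨Ioo_subset_Icc_self hθ, hθ⟩⟩

/-- A function as in `exists_bound_im_logDeriv` has a Lipschitz continuous phase. -/
theorem exists_lipschitz_phase {Ψ : ℝ → ℂ}
    (hΨ : ∀ θ₀ ∈ Icc 0 Real.pi, ∃ g : ℝ → ℂ, AnalyticAt ℝ g θ₀ ∧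
      ∀ᶠ θ in 𝓝[Icc 0 Real.pi] θ₀, g θ = Ψ θ)
    (hne : ∀ θ ∈ Ioo 0 Real.pi, Ψ θ ≠ 0) :
    ∃ (K : NNReal) (φ : ℝ → ℝ), LipschitzWith K φ ∧ ∀ θ ∈ Ioo 0 Real.pi,
      ∃ R : ℝ, 0 < R ∧ Ψ θ = R * Complex.exp (φ θ * Complex.I) := by
  obtain ⟨C, hC⟩ := exists_bound_im_logDeriv hΨ hne
  have han : ∀ θ ∈ Ioo 0 Real.pi, AnalyticAt ℝ Ψ θ := by
    intro θ hθ
    obtain ⟨g, hg, h⟩ := hΨ θ (Ioo_subset_Icc_self hθ)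
    rw [nhdsWithin_eq_nhds.2 (Icc_mem_nhds hθ.1 hθ.2)] at h
    exact hg.congr h
  set ω : ℝ → ℂ := fun θ => deriv Ψ θ / Ψ θ with hω
  have hωc : ContinuousOn ω (Ioo 0 Real.pi) := fun θ hθ =>
    ((han θ hθ).deriv.continuousAt.div (han θ hθ).continuousAt (hne θ hθ)).continuousWithinAt
  have hmid : Real.pi / 2 ∈ Ioo 0 Real.pi := ⟨by positivity, by linarith [Real.pi_pos]⟩
  set L : ℝ → ℂ := fun θ => ∫ t in (Real.pi / 2)..θ, ω t with hL
  have hLd : ∀ θ ∈ Ioo 0 Real.pi, HasDerivAt L (ω θ) θ := by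
    intro θ hθ
    refine intervalIntegral.integral_hasDerivAt_right ?_ ?_
      (hωc.continuousAt (Ioo_mem_nhds hθ.1 hθ.2))
    · exact (hωc.mono (ordConnected_Ioo.uIcc_subset hmid hθ)).intervalIntegrable
    · exact hωc.stronglyMeasurableAtFilter isOpen_Ioo θ hθ
  set φ₀ : ℝ → ℝ := fun θ => (Ψ (Real.pi / 2)).arg + (L θ).im with hφ₀
  have hφd : ∀ θ ∈ Ioo 0 Real.pi, HasDerivAt φ₀ (ω θ).im θ := fun θ hθ =>
    HasDerivAt.const_add _ (Complex.imCLM.hasFDerivAt.comp_hasDerivAt θ (hLd θ hθ))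
  have hlip : LipschitzOnWith C.toNNReal φ₀ (Ioo 0 Real.pi) := by
    refine (convex_Ioo 0 Real.pi).lipschitzOnWith_of_nnnorm_hasDerivWithin_le
      (fun θ hθ => (hφd θ hθ).hasDerivWithinAt) fun θ hθ => ?_
    rw [← NNReal.coe_le_coe, coe_nnnorm, Real.norm_eq_abs]
    exact (hC θ hθ).trans (Real.le_coe_toNNReal C)
  obtain ⟨φ, hφ, hφe⟩ := hlip.extend_real
  refine ⟨_, φ, hφ, fun θ hθ => ?_⟩
  have hconst : Ψ θ * Complex.exp (-L θ) = Ψ (Real.pi / 2) * Complex.exp (-L (Real.pi / 2)) := by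
    refine IsOpen.is_const_of_deriv_eq_zero isOpen_Ioo isPreconnected_Ioo
      (f := fun θ => Ψ θ * Complex.exp (-L θ)) (s := Ioo 0 Real.pi) ?_ ?_ hθ hmid
    · exact fun t ht => ((han t ht).differentiableAt.mul
        (hLd t ht).neg.cexp.differentiableAt).differentiableWithinAt
    · intro t ht
      have := ((han t ht).differentiableAt.hasDerivAt.mul (hLd t ht).neg.cexp).deriv
      refine this.trans ?_
      have h0 := hne t ht
      simp only [hω, Pi.zero_apply]
      field_simp
      simp
  have hL0 : L (Real.pi / 2) = 0 := by simp [hL]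
  rw [hL0, neg_zero, Complex.exp_zero, mul_one] at hconst
  refine ⟨‖Ψ (Real.pi / 2)‖ * Real.exp (L θ).re,
    mul_pos (norm_pos_iff.2 (hne _ hmid)) (Real.exp_pos _), ?_⟩
  have h1 : Ψ θ = Ψ (Real.pi / 2) * Complex.exp (L θ) := by
    rw [← hconst, mul_assoc, ← Complex.exp_add, neg_add_cancel, Complex.exp_zero, mul_one]
  rw [h1, ← hφe hθ]
  nth_rewrite 1 [← Complex.norm_mul_exp_arg_mul_I (Ψ (Real.pi / 2)), ← Complex.re_add_im (L θ)]
  simp only [hφ₀, Complex.ofReal_mul, Complex.ofReal_exp, Complex.ofReal_add, add_mul,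
    Complex.exp_add]
  ring

variable {D : ℝ[X]} {α β : ℝ} {Y : ℝ → ℝ}

/-- For polynomials `P` and `Q` without common zeros in the interior of a band, the function
`Q - e^{-iθ} P` on the band has a phase that is Lipschitz in the angle `θ` up to the edges. -/
theorem IsBandParam.exists_phase (hY : IsBandParam D α β Y)
    (hcrit : ∀ x, |D.eval x| ≤ 2 → D.derivative.eval x = 0 →
      D.eval x * D.derivative.derivative.eval x < 0 ∧ |D.eval x| = 2)
    {P Q : ℝ[X]} (hPQ : ∀ x ∈ Ioo α β, P.eval x = 0 → Q.eval x ≠ 0) :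
    ∃ (K : NNReal) (φ : ℝ → ℝ), LipschitzWith K φ ∧ ∀ θ ∈ Ioo 0 Real.pi, ∃ R : ℝ, 0 < R ∧
      Q.eval (Y θ) - Real.cos θ * P.eval (Y θ) = R * Real.cos (φ θ) ∧
      Real.sin θ * P.eval (Y θ) = R * Real.sin (φ θ) := by
  set Ψ : ℝ → ℂ := fun θ => ((Q.eval (Y θ) - Real.cos θ * P.eval (Y θ) : ℝ) : ℂ) +
    ((Real.sin θ * P.eval (Y θ) : ℝ) : ℂ) * Complex.I with hΨdef
  have hre : ∀ θ, (Ψ θ).re = Q.eval (Y θ) - Real.cos θ * P.eval (Y θ) := fun θ => by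
    simp only [hΨdef, Complex.add_re, Complex.ofReal_re, Complex.re_ofReal_mul, Complex.I_re,
      mul_zero, add_zero]
  have him : ∀ θ, (Ψ θ).im = Real.sin θ * P.eval (Y θ) := fun θ => by
    simp only [hΨdef, Complex.add_im, Complex.ofReal_im, Complex.im_ofReal_mul, Complex.I_im,
      mul_one, zero_add]
  have hΨan : ∀ θ₀ ∈ Icc 0 Real.pi, ∃ g : ℝ → ℂ, AnalyticAt ℝ g θ₀ ∧
      ∀ᶠ θ in 𝓝[Icc 0 Real.pi] θ₀, g θ = Ψ θ := by
    intro θ₀ _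
    obtain ⟨g, hg, hgY⟩ := hY.exists_analyticAt hcrit θ₀
    have hofReal : ∀ {f : ℝ → ℝ}, AnalyticAt ℝ f θ₀ → AnalyticAt ℝ (fun θ => (f θ : ℂ)) θ₀ :=
      fun hf => (Complex.ofRealCLM.analyticAt _).fun_comp hf
    have hpoly : ∀ q : ℝ[X], AnalyticAt ℝ (fun θ => q.eval (g θ)) θ₀ := fun q => by
      simpa using hg.aeval_polynomial q
    refine ⟨fun θ => ((Q.eval (g θ) - Real.cos θ * P.eval (g θ) : ℝ) : ℂ) +
      ((Real.sin θ * P.eval (g θ) : ℝ) : ℂ) * Complex.I, ?_, ?_⟩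
    · exact (hofReal ((hpoly Q).sub (Real.analyticAt_cos.mul (hpoly P)))).add
        ((hofReal (Real.analyticAt_sin.mul (hpoly P))).mul analyticAt_const)
    · filter_upwards [hgY] with θ hθ
      rw [hθ]
  have hΨne : ∀ θ ∈ Ioo 0 Real.pi, Ψ θ ≠ 0 := by
    intro θ hθ h0
    have h1 := hre θ
    have h2 := him θ
    rw [h0, Complex.zero_re] at h1
    rw [h0, Complex.zero_im] at h2
    have hP := (mul_eq_zero.1 h2.symm).resolve_left (Real.sin_pos_of_mem_Ioo hθ).ne'
    rw [hP, mul_zero, sub_zero] at h1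
    exact hPQ _ ((hY.mem_Ioo_iff (Ioo_subset_Icc_self hθ)).2 hθ) hP h1.symm
  obtain ⟨K, φ, hφ, h⟩ := exists_lipschitz_phase hΨan hΨne
  refine ⟨K, φ, hφ, fun θ hθ => ?_⟩
  obtain ⟨R, hR, hΨR⟩ := h θ hθ
  refine ⟨R, hR, ?_, ?_⟩
  · rw [← hre, hΨR, Complex.re_ofReal_mul, Complex.exp_ofReal_mul_I_re]
  · rw [← him, hΨR, Complex.im_ofReal_mul, Complex.exp_ofReal_mul_I_im]

/-- At an edge where `P` and `Q` have a common zero, the phase is a multiple of `π`, provided that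
the derivatives of `Q` and `cos θ₀ P` differ. -/
theorem IsBandParam.sin_phase_eq_zero (hY : IsBandParam D α β Y) {P Q : ℝ[X]} {φ : ℝ → ℝ}
    (hφ : Continuous φ)
    (hphase : ∀ θ ∈ Ioo 0 Real.pi, ∃ R : ℝ, 0 < R ∧
      Q.eval (Y θ) - Real.cos θ * P.eval (Y θ) = R * Real.cos (φ θ) ∧
      Real.sin θ * P.eval (Y θ) = R * Real.sin (φ θ))
    {θ₀ : ℝ} (hθ₀ : θ₀ ∈ Icc 0 Real.pi) (hs : Real.sin θ₀ = 0)
    (hP : P.eval (Y θ₀) = 0) (hQ : Q.eval (Y θ₀) = 0)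
    (hd : Q.derivative.eval (Y θ₀) ≠ Real.cos θ₀ * P.derivative.eval (Y θ₀)) :
    Real.sin (φ θ₀) = 0 := by
  obtain ⟨P₁, hP₁⟩ := dvd_iff_isRoot.2 hP
  obtain ⟨Q₁, hQ₁⟩ := dvd_iff_isRoot.2 hQ
  have hPd : P.derivative.eval (Y θ₀) = P₁.eval (Y θ₀) := by
    rw [hP₁]; simp [derivative_mul]
  have hQd : Q.derivative.eval (Y θ₀) = Q₁.eval (Y θ₀) := by
    rw [hQ₁]; simp [derivative_mul]
  rw [hPd, hQd] at hd
  have hev : ∀ θ ∈ Ioo 0 Real.pi, |Real.sin (φ θ)| *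
      |Q₁.eval (Y θ) - Real.cos θ * P₁.eval (Y θ)| ≤ |Real.sin θ * P₁.eval (Y θ)| := by
    intro θ hθ
    obtain ⟨R, hR, h1, h2⟩ := hphase θ hθ
    have hne : Y θ - Y θ₀ ≠ 0 := by
      refine sub_ne_zero.2 fun h => ?_
      have := hY.injOn (Ioo_subset_Icc_self hθ) hθ₀ h
      exact (Real.sin_pos_of_mem_Ioo hθ).ne' (this ▸ hs)
    have e1 : P.eval (Y θ) = (Y θ - Y θ₀) * P₁.eval (Y θ) := by
      conv_lhs => rw [hP₁]
      simp
    have e2 : Q.eval (Y θ) = (Y θ - Y θ₀) * Q₁.eval (Y θ) := by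
      conv_lhs => rw [hQ₁]
      simp
    refine le_of_mul_le_mul_left ?_ (abs_pos.2 hne)
    have l1 : |Y θ - Y θ₀| * |Q₁.eval (Y θ) - Real.cos θ * P₁.eval (Y θ)| = R * |Real.cos (φ θ)| := by
      rw [← abs_of_pos hR, ← abs_mul, ← abs_mul, ← h1, e1, e2]; congr 1; ring
    have l2 : |Y θ - Y θ₀| * |Real.sin θ * P₁.eval (Y θ)| = R * |Real.sin (φ θ)| := by
      rw [← abs_of_pos hR, ← abs_mul, ← abs_mul, ← h2, e1]; congr 1; ring
    rw [l2, mul_left_comm, l1, mul_left_comm, mul_comm |Real.sin _|]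
    exact mul_le_mul_of_nonneg_left (mul_le_of_le_one_left (abs_nonneg _) (Real.abs_cos_le_one _))
      hR.le
  have hcl : θ₀ ∈ closure (Ioo 0 Real.pi) := by rwa [closure_Ioo Real.pi_pos.ne]
  have hcY := hY.continuous
  have hclosed : IsClosed {θ : ℝ | |Real.sin (φ θ)| *
      |Q₁.eval (Y θ) - Real.cos θ * P₁.eval (Y θ)| ≤ |Real.sin θ * P₁.eval (Y θ)|} := by
    have c1 : Continuous fun θ => Q₁.eval (Y θ) := Q₁.continuous.comp hcY
    have c2 : Continuous fun θ => P₁.eval (Y θ) := P₁.continuous.comp hcY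
    exact isClosed_le (by fun_prop) (by fun_prop)
  have h0 := closure_minimal hev hclosed hcl
  change |Real.sin (φ θ₀)| * |Q₁.eval (Y θ₀) - Real.cos θ₀ * P₁.eval (Y θ₀)| ≤
    |Real.sin θ₀ * P₁.eval (Y θ₀)| at h0
  rw [hs, zero_mul, abs_zero] at h0
  have := (mul_eq_zero.1 (le_antisymm h0 (by positivity))).resolve_right
    (abs_ne_zero.2 (sub_ne_zero.2 hd))
  exact abs_eq_zero.1 this

end Phase

/-! ### Zeros in a band -/

section Zeros

variable {D : ℝ[X]} {α β : ℝ} {Y : ℝ → ℝ} {q : ℕ → ℝ[X]}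

/-- The sequences with `q_{m+2} = D q_{m+1} - q_m` are, on a band, combinations of `sin (mθ)` and
`cos (mθ)`. -/
theorem IsBandParam.sin_mul_eval (hY : IsBandParam D α β Y)
    (hq : ∀ m, q (m + 2) = D * q (m + 1) - q m) (m : ℕ) (θ : ℝ) :
    Real.sin θ * (q m).eval (Y θ) =
      Real.sin (m * θ) * ((q 1).eval (Y θ) - Real.cos θ * (q 0).eval (Y θ)) +
      Real.cos (m * θ) * (Real.sin θ * (q 0).eval (Y θ)) := by
  induction m using Nat.twoStepInduction with
  | zero => simp
  | one => simp; ring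
  | more m h0 h1 =>
    rw [hq, eval_sub, eval_mul, hY.eval_eq]
    have e1 : ((m + 2 : ℕ) : ℝ) * θ = ((m + 1 : ℕ) : ℝ) * θ + θ := by push_cast; ring
    have e0 : (m : ℝ) * θ = ((m + 1 : ℕ) : ℝ) * θ - θ := by push_cast; ring
    rw [e0, Real.sin_sub, Real.cos_sub] at h0
    rw [e1, Real.sin_add, Real.cos_add]
    linear_combination (2 * Real.cos θ) * h1 - h0

theorem IsBandParam.eval_eq_zero_iff (hY : IsBandParam D α β Y)
    (hq : ∀ m, q (m + 2) = D * q (m + 1) - q m) {φ : ℝ → ℝ}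
    (hphase : ∀ θ ∈ Ioo 0 Real.pi, ∃ R : ℝ, 0 < R ∧
      (q 1).eval (Y θ) - Real.cos θ * (q 0).eval (Y θ) = R * Real.cos (φ θ) ∧
      Real.sin θ * (q 0).eval (Y θ) = R * Real.sin (φ θ))
    (m : ℕ) {θ : ℝ} (hθ : θ ∈ Ioo 0 Real.pi) :
    (q m).eval (Y θ) = 0 ↔ Real.sin (m * θ + φ θ) = 0 := by
  obtain ⟨R, hR, h1, h2⟩ := hphase θ hθ
  have h := hY.sin_mul_eval hq m θ
  rw [h1, h2] at h
  have h3 : Real.sin θ * (q m).eval (Y θ) = R * Real.sin (m * θ + φ θ) := by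
    rw [h, Real.sin_add]; ring
  have hs := (Real.sin_pos_of_mem_Ioo hθ).ne'
  constructor
  · intro h0
    rw [h0, mul_zero] at h3
    exact (mul_eq_zero.1 h3.symm).resolve_left hR.ne'
  · intro h0
    rw [h0, mul_zero] at h3
    exact (mul_eq_zero.1 h3).resolve_left hs

/-- At a point where `D = 2s` with `s = ±1`, the sequence is `s ^ m` times an affine function
of `m`. Hence it vanishes for all `m`, or for all large `m` it does not vanish. -/
theorem eval_eq_zero_or_eventually_ne_zero {x s : ℝ} (hs : s ^ 2 = 1) (hx : D.eval x = 2 * s)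
    (hq : ∀ m, q (m + 2) = D * q (m + 1) - q m) :
    ((q 0).eval x = 0 ∧ (q 1).eval x = 0 ∧ ∀ m, (q m).eval x = 0) ∨
      ∀ᶠ m in atTop, (q m).eval x ≠ 0 := by
  set u := (q 0).eval x
  set v := s * (q 1).eval x - u with hv
  have hform : ∀ m, (q m).eval x = s ^ m * (u + m * v) := by
    intro m
    induction m using Nat.twoStepInduction with
    | zero => simp [u]
    | one =>
      rw [hv]
      push_cast
      linear_combination (-(q 1).eval x) * hs
    | more m h0 h1 =>
      rw [hq, eval_sub, eval_mul, hx, h0, h1]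
      push_cast
      linear_combination (s ^ m * (u + m * v)) * hs
  have hs0 : s ≠ 0 := by rintro rfl; norm_num at hs
  by_cases hv0 : v = 0
  · by_cases hu0 : u = 0
    · exact Or.inl ⟨hu0, by simpa [hv0, hu0] using hform 1, fun m => by rw [hform, hv0, hu0]; simp⟩
    · refine Or.inr (Eventually.of_forall fun m => ?_)
      rw [hform, hv0, mul_zero, add_zero]
      exact mul_ne_zero (pow_ne_zero _ hs0) hu0
  · refine Or.inr ?_
    filter_upwards [eventually_gt_atTop ⌈|u| / |v|⌉₊] with m hm
    rw [hform]
    refine mul_ne_zero (pow_ne_zero _ hs0) fun h => ?_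
    have h1 : |u| / |v| < m := (Nat.le_ceil _).trans_lt (by exact_mod_cast hm)
    rw [div_lt_iff₀ (abs_pos.2 hv0)] at h1
    have h2 : u = -(m * v) := by linarith
    rw [h2, abs_neg, abs_mul, Nat.abs_cast] at h1
    exact lt_irrefl _ h1

/-- The strictly monotone phase `mθ + φ(θ)` whose multiples of `π` are the zeros. -/
theorem strictMono_phase {K : NNReal} {φ : ℝ → ℝ} (hφ : LipschitzWith K φ) {m : ℝ} (hm : K < m) :
    StrictMono fun θ => m * θ + φ θ := by
  intro x y hxy
  have h := hφ.dist_le_mul y x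
  rw [Real.dist_eq, Real.dist_eq, abs_of_pos (sub_pos.2 hxy)] at h
  have h1 := neg_abs_le (φ y - φ x)
  have h2 := mul_lt_mul_of_pos_right hm (sub_pos.2 hxy)
  change m * x + φ x < m * y + φ y
  nlinarith

/-- The number of solutions of `mθ + φ(θ) ∈ πℤ` in the open interval `(0, π)`. -/
theorem ncard_phase_zeros {K : NNReal} {φ : ℝ → ℝ} (hφ : LipschitzWith K φ) {m : ℕ}
    (hm : (K : ℝ) < m) :
    {θ ∈ Ioo 0 Real.pi | Real.sin (m * θ + φ θ) = 0}.ncard =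
      ((m : ℤ) + ⌈φ Real.pi / Real.pi⌉ - ⌊φ 0 / Real.pi⌋ - 1).toNat := by
  set ψ : ℝ → ℝ := fun θ => (m * θ + φ θ) / Real.pi with hψ
  have hpi := Real.pi_pos
  have hmono : StrictMono ψ := fun x y hxy =>
    div_lt_div_of_pos_right (strictMono_phase hφ hm hxy) hpi
  have hcont : Continuous ψ := by
    have := hφ.continuous
    fun_prop
  have h0 : ψ 0 = φ 0 / Real.pi := by simp [hψ]
  have h1 : ψ Real.pi = m + φ Real.pi / Real.pi := by
    simp only [hψ]; field_simp
  have himage : ψ '' {θ ∈ Ioo 0 Real.pi | Real.sin (m * θ + φ θ) = 0} =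
      (fun k : ℤ => (k : ℝ)) '' Ioo ⌊φ 0 / Real.pi⌋ ((m : ℤ) + ⌈φ Real.pi / Real.pi⌉) := by
    ext y
    constructor
    · rintro ⟨θ, ⟨hθ, hs⟩, rfl⟩
      obtain ⟨k, hk⟩ := Real.sin_eq_zero_iff.1 hs
      have hky : ψ θ = k := by rw [hψ]; simp only; rw [← hk]; field_simp
      refine ⟨k, ⟨?_, ?_⟩, hky.symm⟩
      · rw [Int.floor_lt, ← h0, ← hky]; exact hmono hθ.1
      · rw [← sub_lt_iff_lt_add', Int.lt_ceil]
        push_cast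
        rw [sub_lt_iff_lt_add', ← h1, ← hky]; exact hmono hθ.2
    · rintro ⟨k, ⟨hk1, hk2⟩, rfl⟩
      rw [Int.floor_lt, ← h0] at hk1
      rw [← sub_lt_iff_lt_add', Int.lt_ceil] at hk2
      push_cast at hk2
      rw [sub_lt_iff_lt_add', ← h1] at hk2
      obtain ⟨θ, hθ, hk⟩ := intermediate_value_Ioo hpi.le hcont.continuousOn ⟨hk1, hk2⟩
      refine ⟨θ, ⟨hθ, Real.sin_eq_zero_iff.2 ⟨k, ?_⟩⟩, hk⟩
      simp only [← hk, hψ]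
      field_simp
  rw [← ncard_image_of_injective _ hmono.injective, himage,
    ncard_image_of_injective _ Int.cast_injective, ← Finset.coe_Ioo, ncard_coe_finset, Int.card_Ioo]

/-- The hypotheses on a sequence of polynomials `q_m` and a band of `D` under which zeros are
counted and located. They hold for `q_m = p_{n+mp}` and `D = Δ`. -/
structure IsFloquetSequence (D : ℝ[X]) (α β : ℝ) (q : ℕ → ℝ[X]) : Prop where
  recurrence : ∀ m, q (m + 2) = D * q (m + 1) - q m
  critical : ∀ x, |D.eval x| ≤ 2 → D.derivative.eval x = 0 →
    D.eval x * D.derivative.derivative.eval x < 0 ∧ |D.eval x| = 2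
  interior : ∀ x ∈ Ioo α β, (q 0).eval x = 0 → (q 1).eval x ≠ 0
  edge : ∀ x s, s ^ 2 = 1 → D.eval x = 2 * s → (q 0).eval x = 0 → (q 1).eval x = 0 →
    (q 1).derivative.eval x ≠ s * (q 0).derivative.eval x

/-- The zeros of `q_m` are located by one phase `φ` for all `m`. At an edge this holds only for large
`m`: there a zero of `q_m` for more than one `m` forces all `q_m` to vanish. -/
theorem IsFloquetSequence.exists_phase (h : IsFloquetSequence D α β q)
    (hY : IsBandParam D α β Y) :
    ∃ (K : NNReal) (φ : ℝ → ℝ), LipschitzWith K φ ∧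
      (∀ m : ℕ, ∀ θ ∈ Ioo 0 Real.pi, (q m).eval (Y θ) = 0 ↔ Real.sin (m * θ + φ θ) = 0) ∧
      ∀ᶠ m : ℕ in atTop, ∀ θ ∈ Icc 0 Real.pi, (q m).eval (Y θ) = 0 →
        Real.sin (m * θ + φ θ) = 0 := by
  obtain ⟨K, φ, hφ, hphase⟩ := hY.exists_phase h.critical h.interior
  have hiff := fun (m : ℕ) θ (hθ : θ ∈ Ioo 0 Real.pi) =>
    hY.eval_eq_zero_iff h.recurrence hphase m hθ
  refine ⟨K, φ, hφ, hiff, ?_⟩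
  have hedge : ∀ θ ∈ Icc 0 Real.pi, Real.cos θ ^ 2 = 1 → (∀ m : ℕ, Real.sin (m * θ) = 0) →
      ∀ᶠ m : ℕ in atTop, (q m).eval (Y θ) = 0 → Real.sin (m * θ + φ θ) = 0 := by
    intro θ hθ hc hm
    rcases eval_eq_zero_or_eventually_ne_zero hc (hY.eval_eq θ) h.recurrence with h0 | h0
    · have hs : Real.sin θ = 0 := by simpa using hm 1
      have := hY.sin_phase_eq_zero hφ.continuous hphase hθ hs h0.1 h0.2.1
        (h.edge _ _ hc (hY.eval_eq θ) h0.1 h0.2.1)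
      exact Eventually.of_forall fun m _ => by rw [Real.sin_add, this, hm]; simp
    · filter_upwards [h0] with m h1 h2 using absurd h2 h1
  filter_upwards [hedge 0 (left_mem_Icc.2 Real.pi_pos.le) (by simp) (by simp),
    hedge Real.pi (right_mem_Icc.2 Real.pi_pos.le) (by simp) Real.sin_nat_mul_pi]
    with m h1 h2 θ hθ hz
  rcases hθ.1.eq_or_lt with rfl | h3
  · exact h1 hz
  rcases hθ.2.eq_or_lt with rfl | h4
  · exact h2 hz
  · exact (hiff m θ ⟨h3, h4⟩).1 hz

/-- Consecutive zeros of `q_m` in a band are `π / m + O(1 / m²)` apart in the angle. -/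
theorem IsFloquetSequence.exists_spacing (h : IsFloquetSequence D α β q)
    (hY : IsBandParam D α β Y) :
    ∃ K : ℝ, 0 ≤ K ∧ ∀ᶠ m : ℕ in atTop, ∀ θ ∈ Icc 0 Real.pi, ∀ θ' ∈ Icc 0 Real.pi, θ < θ' →
      (q m).eval (Y θ) = 0 → (q m).eval (Y θ') = 0 →
      (∀ t ∈ Ioo θ θ', (q m).eval (Y t) ≠ 0) → |m * (θ' - θ) - Real.pi| ≤ K / m := by
  obtain ⟨K, φ, hφ, hiff, hzero⟩ := h.exists_phase hY
  refine ⟨K * (2 * Real.pi), by positivity, ?_⟩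
  filter_upwards [hzero, eventually_gt_atTop (2 * ⌈(K : ℝ)⌉₊)] with m hz hm θ hθ θ' hθ' hlt h0 h1 hno
  have hpi := Real.pi_pos
  have hKm : 2 * (K : ℝ) < m := by
    have : (2 * ⌈(K : ℝ)⌉₊ : ℝ) < m := by exact_mod_cast hm
    linarith [Nat.le_ceil (K : ℝ)]
  have hK0 : (0 : ℝ) ≤ K := K.2
  have hm0 : (0 : ℝ) < m := by linarith
  have hmono := strictMono_phase hφ (m := m) (by linarith)
  have hcont : Continuous fun θ : ℝ => m * θ + φ θ := by
    have := hφ.continuous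
    fun_prop
  obtain ⟨k, hk⟩ := Real.sin_eq_zero_iff.1 (hz θ hθ h0)
  obtain ⟨k', hk'⟩ := Real.sin_eq_zero_iff.1 (hz θ' hθ' h1)
  have hkk : k < k' := by
    have := hmono hlt
    simp only [← hk, ← hk'] at this
    exact_mod_cast lt_of_mul_lt_mul_right this hpi.le
  -- between two zeros that differ by more than `π` in phase there is another one
  have hk1 : k' = k + 1 := by
    by_contra hne
    have hlt' : k + 1 < k' := lt_of_le_of_ne hkk (Ne.symm hne)
    have hlt'' : (k : ℝ) + 1 < k' := by exact_mod_cast hlt'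
    obtain ⟨t, ht, htk⟩ := intermediate_value_Ioo hlt.le hcont.continuousOn
      (show (k + 1 : ℝ) * Real.pi ∈ Ioo (m * θ + φ θ) (m * θ' + φ θ') by
        rw [← hk, ← hk']
        exact ⟨by nlinarith, by nlinarith⟩)
    refine hno t ht ((hiff m t ⟨hθ.1.trans_lt ht.1, ht.2.trans_le hθ'.2⟩).2 ?_)
    exact Real.sin_eq_zero_iff.2 ⟨k + 1, by push_cast; exact htk.symm⟩
  have heq : m * (θ' - θ) + (φ θ' - φ θ) = Real.pi := by
    rw [hk1] at hk'
    push_cast at hk'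
    linarith
  have hlip := hφ.dist_le_mul θ' θ
  rw [Real.dist_eq, Real.dist_eq, abs_of_pos (sub_pos.2 hlt)] at hlip
  have hδ : m * (θ' - θ) ≤ 2 * Real.pi := by
    have := neg_abs_le (φ θ' - φ θ)
    have := mul_lt_mul_of_pos_right hKm (sub_pos.2 hlt)
    linarith
  have habs : |m * (θ' - θ) - Real.pi| = |φ θ' - φ θ| := by
    rw [← abs_neg]; congr 1; linarith
  rw [habs, le_div_iff₀ hm0]
  calc |φ θ' - φ θ| * m ≤ K * (θ' - θ) * m := mul_le_mul_of_nonneg_right hlip hm0.le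
    _ = K * (m * (θ' - θ)) := by ring
    _ ≤ K * (2 * Real.pi) := mul_le_mul_of_nonneg_left hδ hK0

theorem IsFloquetSequence.exists_ncard_Ioo (h : IsFloquetSequence D α β q)
    (hY : IsBandParam D α β Y) :
    ∃ d : ℤ, ∀ᶠ m : ℕ in atTop, {x ∈ Ioo α β | (q m).eval x = 0}.Finite ∧
      ({x ∈ Ioo α β | (q m).eval x = 0}.ncard : ℤ) = m - d := by
  obtain ⟨K, φ, hφ, hiff, -⟩ := h.exists_phase hY
  refine ⟨⌊φ 0 / Real.pi⌋ + 1 - ⌈φ Real.pi / Real.pi⌉, ?_⟩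
  filter_upwards [eventually_gt_atTop ⌈(K : ℝ)⌉₊,
    eventually_gt_atTop (⌊φ 0 / Real.pi⌋ + 1 - ⌈φ Real.pi / Real.pi⌉).toNat] with m hm hm'
  have hKm : (K : ℝ) < m := (Nat.le_ceil _).trans_lt (by exact_mod_cast hm)
  have hset : {x ∈ Ioo α β | (q m).eval x = 0} =
      Y '' {θ ∈ Ioo 0 Real.pi | Real.sin (m * θ + φ θ) = 0} := by
    ext x
    constructor
    · rintro ⟨hx, h0⟩
      obtain ⟨θ, hθ, rfl⟩ := hY.exists_eq (Ioo_subset_Icc_self hx)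
      have hθ' := (hY.mem_Ioo_iff hθ).1 hx
      exact ⟨θ, ⟨hθ', (hiff m θ hθ').1 h0⟩, rfl⟩
    · rintro ⟨θ, ⟨hθ, h0⟩, rfl⟩
      exact ⟨(hY.mem_Ioo_iff (Ioo_subset_Icc_self hθ)).2 hθ, (hiff m θ hθ).2 h0⟩
  have hcard : ({x ∈ Ioo α β | (q m).eval x = 0}.ncard : ℤ) =
      m - (⌊φ 0 / Real.pi⌋ + 1 - ⌈φ Real.pi / Real.pi⌉) := by
    rw [hset, (hY.injOn.mono fun θ hθ => Ioo_subset_Icc_self hθ.1).ncard_image,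
      ncard_phase_zeros hφ hKm]
    omega
  exact ⟨finite_of_ncard_pos (by omega), hcard⟩

theorem IsFloquetSequence.exists_ncard_Icc (h : IsFloquetSequence D α β q)
    (hY : IsBandParam D α β Y) :
    ∃ d : ℤ, ∀ᶠ m : ℕ in atTop, ({x ∈ Icc α β | (q m).eval x = 0}.ncard : ℤ) = m - d := by
  obtain ⟨d, hd⟩ := h.exists_ncard_Ioo hY
  set E : Set ℝ := {x ∈ ({α, β} : Set ℝ) | ∀ m, (q m).eval x = 0} with hE
  have hEfin : E.Finite := (Set.toFinite {α, β}).subset fun x hx => hx.1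
  have hev : ∀ x ∈ ({α, β} : Set ℝ), ∀ᶠ m in atTop, (q m).eval x = 0 ↔ x ∈ E := by
    intro x hx
    have hs : ∃ s : ℝ, s ^ 2 = 1 ∧ D.eval x = 2 * s := by
      have habs : |D.eval x| = 2 := by
        rcases hx with rfl | rfl
        · exact hY.isBand.abs_left
        · exact hY.isBand.abs_right
      refine ⟨D.eval x / 2, ?_, by ring⟩
      rw [div_pow, ← sq_abs, habs]; norm_num
    obtain ⟨s, hs, hxs⟩ := hs
    rcases eval_eq_zero_or_eventually_ne_zero hs hxs h.recurrence with h0 | h0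
    · exact Eventually.of_forall fun m => ⟨fun _ => ⟨hx, h0.2.2⟩, fun _ => h0.2.2 m⟩
    · filter_upwards [h0] with m hm
      exact ⟨fun h1 => absurd h1 hm, fun h1 => absurd (h1.2 m) hm⟩
  refine ⟨d - E.ncard, ?_⟩
  filter_upwards [hd, hev α (by simp), hev β (by simp)] with m hm h1 h2
  have hset : {x ∈ Icc α β | (q m).eval x = 0} = {x ∈ Ioo α β | (q m).eval x = 0} ∪ E := by
    ext x
    constructor
    · rintro ⟨hx, h0⟩
      rcases hx.1.eq_or_lt with rfl | h3
      · exact Or.inr (h1.1 h0)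
      rcases hx.2.eq_or_lt with rfl | h4
      · exact Or.inr (h2.1 h0)
      · exact Or.inl ⟨⟨h3, h4⟩, h0⟩
    · rintro (⟨hx, h0⟩ | hx)
      · exact ⟨Ioo_subset_Icc_self hx, h0⟩
      · refine ⟨?_, hx.2 m⟩
        rcases hx.1 with rfl | rfl
        · exact left_mem_Icc.2 hY.isBand.lt.le
        · exact right_mem_Icc.2 hY.isBand.lt.le
  have hdisj : Disjoint {x ∈ Ioo α β | (q m).eval x = 0} E := by
    rw [Set.disjoint_left]
    rintro x ⟨hx, -⟩ ⟨hx', -⟩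
    rcases hx' with rfl | rfl
    · exact lt_irrefl _ hx.1
    · exact lt_irrefl _ hx.2
  rw [hset, ncard_union_eq hdisj hm.1 hEfin]
  push_cast
  rw [hm.2]
  ring

end Zeros

/-! ### Positive definiteness of the logarithmic energy -/

section Energy

open MeasureTheory ProbabilityTheory

/-- The kernel `log (A / |x - y|)`, with the value `⊤` on the diagonal. It is nonnegative
where `|x - y| ≤ A`. -/
def shiftedKernel (A x y : ℝ) : ENNReal :=
  if x = y then ⊤ else ENNReal.ofReal (Real.log A - Real.log |x - y|)

theorem measurable_shiftedKernel (A : ℝ) :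
    Measurable (Function.uncurry (shiftedKernel A)) := by
  refine Measurable.ite (measurableSet_eq_fun measurable_fst measurable_snd) measurable_const ?_
  refine ENNReal.measurable_ofReal.comp (measurable_const.sub (Real.measurable_log.comp ?_))
  exact (continuous_fst.sub continuous_snd).abs.measurable

/-- The mutual energy of two measures for the kernel `log (A / |x - y|)`. -/
def mutualEnergy (A : ℝ) (μ ν : Measure ℝ) : ENNReal :=
  ∫⁻ x, ∫⁻ y, shiftedKernel A x y ∂ν ∂μ

theorem lintegral_exp_sub_exp_div {u v : ℝ} (hu : 0 ≤ u) (huv : u ≤ v) :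
    ∫⁻ t in Ioi (0 : ℝ), ENNReal.ofReal ((Real.exp (-(t * u)) - Real.exp (-(t * v))) / t) =
      ∫⁻ s in Ioc u v, ENNReal.ofReal s⁻¹ := by
  have h1 : ∀ t ∈ Ioi (0 : ℝ),
      ENNReal.ofReal ((Real.exp (-(t * u)) - Real.exp (-(t * v))) / t) =
        ∫⁻ s in Ioc u v, ENNReal.ofReal (Real.exp (-(t * s))) := by
    intro t ht
    have hint : IntervalIntegrable (fun s => Real.exp (-(t * s))) volume u v :=
      (by fun_prop : Continuous fun s => Real.exp (-(t * s))).intervalIntegrable _ _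
    rw [← ofReal_integral_eq_lintegral_ofReal ((intervalIntegrable_iff_integrableOn_Ioc_of_le
      huv).1 hint) (Eventually.of_forall fun s => (Real.exp_pos _).le),
      ← intervalIntegral.integral_of_le huv]
    congr 1
    have hd : ∀ s ∈ uIcc u v, HasDerivAt (fun s => -Real.exp (-(t * s)) / t)
        (Real.exp (-(t * s))) s := by
      intro s _
      have := ((((hasDerivAt_id s).const_mul t).neg.exp).neg.div_const t)
      have ht0 : t ≠ 0 := (mem_Ioi.1 ht).ne'
      refine this.congr_deriv ?_
      rw [mul_one, mul_neg, neg_neg, mul_div_cancel_right₀ _ ht0]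
      rfl
    rw [intervalIntegral.integral_eq_sub_of_hasDerivAt hd hint]
    ring
  have h2 : ∀ s ∈ Ioc u v, ∫⁻ t in Ioi (0 : ℝ), ENNReal.ofReal (Real.exp (-(t * s))) =
      ENNReal.ofReal s⁻¹ := by
    intro s hs
    have hs0 : -s < 0 := by linarith [hs.1]
    have he : ∀ t : ℝ, Real.exp (-(t * s)) = Real.exp (-s * t) := fun t => by
      congr 1; ring
    simp_rw [he]
    rw [← ofReal_integral_eq_lintegral_ofReal (integrableOn_exp_mul_Ioi hs0 0)
      (Eventually.of_forall fun s => (Real.exp_pos _).le), integral_exp_mul_Ioi hs0]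
    simp
  rw [setLIntegral_congr_fun measurableSet_Ioi h1, lintegral_lintegral_swap,
    setLIntegral_congr_fun measurableSet_Ioc h2]
  exact (by fun_prop : Measurable fun z : ℝ × ℝ =>
    ENNReal.ofReal (Real.exp (-(z.1 * z.2)))).aemeasurable

theorem lintegral_Ioc_zero_inv {v : ℝ} (hv : 0 < v) :
    ∫⁻ s in Ioc 0 v, ENNReal.ofReal s⁻¹ = ⊤ := by
  by_contra h
  have hint : IntegrableOn (fun s : ℝ => s⁻¹) (Ioc 0 v) := by
    refine ⟨measurable_inv.aestronglyMeasurable, ?_⟩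
    rw [hasFiniteIntegral_iff_ofReal]
    · exact lt_top_iff_ne_top.2 h
    · filter_upwards [self_mem_ae_restrict measurableSet_Ioc] with s hs
      exact inv_nonneg.2 hs.1.le
  have := (intervalIntegrable_iff_integrableOn_Ioc_of_le hv.le).2 hint
  rw [intervalIntegrable_inv_iff] at this
  rcases this with h | h
  · exact hv.ne h
  · exact h (left_mem_uIcc)

/-- Frullani's formula: the kernel `log (A / |x - y|)` is a superposition of Gaussians, up to
constants. -/
theorem shiftedKernel_eq_lintegral {A x y : ℝ} (hA : 0 < A) (hxy : |x - y| ≤ A) :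
    shiftedKernel A x y = ∫⁻ t in Ioi (0 : ℝ),
      ENNReal.ofReal ((Real.exp (-(t * (x - y) ^ 2)) - Real.exp (-(t * A ^ 2))) / (2 * t)) := by
  have hsq : (x - y) ^ 2 ≤ A ^ 2 := sq_le_sq' (abs_le.1 hxy).1 (abs_le.1 hxy).2
  have h1 : ∀ t : ℝ,
      ENNReal.ofReal ((Real.exp (-(t * (x - y) ^ 2)) - Real.exp (-(t * A ^ 2))) / (2 * t)) =
      ENNReal.ofReal (1 / 2) *
        ENNReal.ofReal ((Real.exp (-(t * (x - y) ^ 2)) - Real.exp (-(t * A ^ 2))) / t) := by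
    intro t
    rw [← ENNReal.ofReal_mul (by norm_num)]
    congr 1
    rw [div_mul_div_comm, one_mul]
  simp_rw [h1]
  rw [lintegral_const_mul' _ _ ENNReal.ofReal_ne_top,
    lintegral_exp_sub_exp_div (sq_nonneg _) hsq, shiftedKernel]
  split_ifs with h
  · rw [h, sub_self, zero_pow two_ne_zero, lintegral_Ioc_zero_inv (by positivity),
      ENNReal.mul_top (by simp)]
  · have h0 : 0 < |x - y| := abs_pos.2 (sub_ne_zero.2 h)
    have h2 : 0 < (x - y) ^ 2 := by rw [← sq_abs]; positivity
    have hint : IntervalIntegrable (fun s : ℝ => s⁻¹) volume ((x - y) ^ 2) (A ^ 2) := by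
      rw [intervalIntegrable_inv_iff, uIcc_of_le hsq]
      exact Or.inr fun hm => (h2.trans_le hm.1).false
    rw [← ofReal_integral_eq_lintegral_ofReal
      ((intervalIntegrable_iff_integrableOn_Ioc_of_le hsq).1 hint), ←
      intervalIntegral.integral_of_le hsq, integral_inv_of_pos h2 (by positivity),
      ← ENNReal.ofReal_mul (by norm_num), Real.log_div (by positivity) h2.ne', ← sq_abs (x - y),
      Real.log_pow, Real.log_pow]
    · congr 1; push_cast; ring
    · filter_upwards [self_mem_ae_restrict measurableSet_Ioc] with s hs
      exact inv_nonneg.2 (h2.trans hs.1).le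

theorem integral_add_sub_two_mul {X : Type*} [MeasurableSpace X] {ρ : Measure X} {f g h : X → ℝ}
    (hf : Integrable f ρ) (hg : Integrable g ρ) (hh : Integrable h ρ) :
    ∫ x, (f x + g x - 2 * h x) ∂ρ = ∫ x, f x ∂ρ + ∫ x, g x ∂ρ - 2 * ∫ x, h x ∂ρ := by
  refine (integral_sub (hf.add hg) (hh.const_mul 2)).trans ?_
  rw [integral_const_mul, integral_add' hf hg]

/-- The mutual energy of two measures for the Gaussian kernel `exp (-t (x - y)²)`. -/
def gaussEnergy (μ ν : Measure ℝ) (t : ℝ) : ℝ :=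
  ∫ z : ℝ × ℝ, Real.exp (-(t * (z.1 - z.2) ^ 2)) ∂(μ.prod ν)

theorem integrable_gauss (μ ν : Measure ℝ) [IsProbabilityMeasure μ] [IsProbabilityMeasure ν]
    {t : ℝ} (ht : 0 ≤ t) :
    Integrable (fun z : ℝ × ℝ => Real.exp (-(t * (z.1 - z.2) ^ 2))) (μ.prod ν) := by
  refine Integrable.of_bound (C := 1) (by fun_prop) (Eventually.of_forall fun z => ?_)
  rw [Real.norm_eq_abs, Real.abs_exp]
  exact Real.exp_le_one_iff.2 (neg_nonpos.2 (by positivity))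

/-- The Gaussian energy in terms of characteristic functions. -/
theorem gaussEnergy_eq_integral_charFun (μ ν : Measure ℝ) [IsProbabilityMeasure μ]
    [IsProbabilityMeasure ν] (v : NNReal) :
    (gaussEnergy μ ν (v / 2) : ℂ) =
      ∫ s, charFun μ s * charFun ν (-s) ∂(gaussianReal 0 v) := by
  have h1 : ∀ z : ℝ × ℝ, ((Real.exp (-((v : ℝ) / 2 * (z.1 - z.2) ^ 2)) : ℝ) : ℂ) =
      ∫ s, Complex.exp (s * z.1 * Complex.I) * Complex.exp (((-s : ℝ) : ℂ) * z.2 * Complex.I)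
        ∂(gaussianReal 0 v) := by
    intro z
    have := charFun_gaussianReal (μ := 0) (v := v) (z.1 - z.2)
    rw [charFun_apply_real] at this
    rw [Complex.ofReal_exp]
    convert this.symm using 1
    · congr 1; push_cast; ring
    · congr 1; ext s; rw [← Complex.exp_add]; congr 1; push_cast; ring
  have h2 : ∀ s, charFun μ s * charFun ν (-s) = ∫ z : ℝ × ℝ, Complex.exp (s * z.1 * Complex.I) *
      Complex.exp (((-s : ℝ) : ℂ) * z.2 * Complex.I) ∂(μ.prod ν) := by
    intro s
    rw [charFun_apply_real, charFun_apply_real, ← integral_prod_mul]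
  simp_rw [h2]
  rw [gaussEnergy, ← integral_complex_ofReal, integral_integral_swap, integral_congr_ae]
  · exact Eventually.of_forall h1
  · refine Integrable.of_bound (C := 1) (by fun_prop) (Eventually.of_forall fun z => ?_)
    simp only [Function.uncurry, norm_mul]
    rw [← Complex.ofReal_mul, ← Complex.ofReal_mul, Complex.norm_exp_ofReal_mul_I,
      Complex.norm_exp_ofReal_mul_I, one_mul]

theorem integrable_charFun_mul (μ ν : Measure ℝ) [IsProbabilityMeasure μ] [IsProbabilityMeasure ν]
    (v : NNReal) : Integrable (fun s => charFun μ s * charFun ν (-s)) (gaussianReal 0 v) := by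
  refine Integrable.of_bound (C := 1) ?_ (Eventually.of_forall fun s => ?_)
  · exact (continuous_charFun.mul (continuous_charFun.comp continuous_neg)).aestronglyMeasurable
  · rw [norm_mul]
    exact mul_le_one₀ (norm_charFun_le_one _) (norm_nonneg _) (norm_charFun_le_one _)

/-- Positive definiteness of the Gaussian kernel: the energy of a difference of probability
measures is the mean square of the difference of the characteristic functions. -/
theorem gaussEnergy_add_sub (μ ν : Measure ℝ) [IsProbabilityMeasure μ] [IsProbabilityMeasure ν]
    (v : NNReal) :
    gaussEnergy μ μ (v / 2) + gaussEnergy ν ν (v / 2) - 2 * gaussEnergy μ ν (v / 2) =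
      ∫ s, ‖charFun μ s - charFun ν s‖ ^ 2 ∂(gaussianReal 0 v) := by
  have hre : ∀ (μ ν : Measure ℝ) [IsProbabilityMeasure μ] [IsProbabilityMeasure ν],
      gaussEnergy μ ν (v / 2) = ∫ s, (charFun μ s * charFun ν (-s)).re ∂(gaussianReal 0 v) := by
    intro μ ν _ _
    have h := congrArg Complex.re (gaussEnergy_eq_integral_charFun μ ν v)
    rw [Complex.ofReal_re] at h
    rw [h]
    exact (integral_re (integrable_charFun_mul μ ν v)).symm
  have hint := fun (μ ν : Measure ℝ) [IsProbabilityMeasure μ] [IsProbabilityMeasure ν] =>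
    (integrable_charFun_mul μ ν v).re
  rw [hre, hre, hre]
  refine (integral_add_sub_two_mul (hint μ μ) (hint ν ν) (hint μ ν)).symm.trans ?_
  congr 1
  ext s
  change (charFun μ s * charFun μ (-s)).re + (charFun ν s * charFun ν (-s)).re -
    2 * (charFun μ s * charFun ν (-s)).re = _
  rw [charFun_neg, charFun_neg, Complex.mul_conj, Complex.mul_conj, ← Complex.normSq_eq_norm_sq,
    Complex.normSq_sub, Complex.ofReal_re, Complex.ofReal_re]

/-- The energy of a difference of probability measures, for the Gaussian kernel, vanishes only
if the measures agree. -/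
theorem eq_of_gaussEnergy {μ ν : Measure ℝ} [IsProbabilityMeasure μ] [IsProbabilityMeasure ν]
    {v : NNReal} (hv : v ≠ 0)
    (h : gaussEnergy μ μ (v / 2) + gaussEnergy ν ν (v / 2) - 2 * gaussEnergy μ ν (v / 2) = 0) :
    μ = ν := by
  refine Measure.ext_of_charFun ?_
  rw [gaussEnergy_add_sub] at h
  have hc : Continuous fun s => ‖charFun μ s - charFun ν s‖ ^ 2 :=
    ((continuous_charFun.sub continuous_charFun).norm).pow 2
  have hint : Integrable (fun s => ‖charFun μ s - charFun ν s‖ ^ 2) (gaussianReal 0 v) := by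
    refine Integrable.of_bound (C := 2 ^ 2) hc.aestronglyMeasurable (Eventually.of_forall fun s => ?_)
    rw [Real.norm_eq_abs, abs_of_nonneg (by positivity)]
    refine pow_le_pow_left₀ (norm_nonneg _) ((norm_sub_le _ _).trans ?_) 2
    linarith [norm_charFun_le_one (μ := μ) s, norm_charFun_le_one (μ := ν) s]
  have h0 := (integral_eq_zero_iff_of_nonneg (fun s => by positivity) hint).1 h
  have h1 := (gaussianReal_absolutelyContinuous' 0 hv).ae_le h0
  have h2 := (Continuous.ae_eq_iff_eq volume hc continuous_const).1 h1
  ext s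
  have h3 := congrFun h2 s
  exact sub_eq_zero.1 (norm_eq_zero.1 ((pow_eq_zero_iff two_ne_zero).1 h3))

theorem ae_prod_abs_sub_le {A : ℝ} {S : Set ℝ} (hS : ∀ x ∈ S, ∀ y ∈ S, |x - y| ≤ A)
    {μ ν : Measure ℝ} [SFinite μ] [SFinite ν] (hμ : μ Sᶜ = 0) (hν : ν Sᶜ = 0) :
    ∀ᵐ z ∂(μ.prod ν), |z.1 - z.2| ≤ A := by
  have hμ' : ∀ᵐ x ∂μ, x ∈ S := hμ
  have hν' : ∀ᵐ x ∂ν, x ∈ S := hν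
  filter_upwards [Measure.quasiMeasurePreserving_fst.ae hμ',
    Measure.quasiMeasurePreserving_snd.ae hν'] with z h1 h2 using hS _ h1 _ h2

/-- The mutual energy as a superposition of Gaussian energies. -/
theorem mutualEnergy_eq_lintegral {A : ℝ} (hA : 0 < A) {S : Set ℝ}
    (hS : ∀ x ∈ S, ∀ y ∈ S, |x - y| ≤ A) {μ ν : Measure ℝ} [IsProbabilityMeasure μ]
    [IsProbabilityMeasure ν] (hμ : μ Sᶜ = 0) (hν : ν Sᶜ = 0) :
    (∀ t ∈ Ioi (0 : ℝ), 0 ≤ (gaussEnergy μ ν t - Real.exp (-(t * A ^ 2))) / (2 * t)) ∧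
    mutualEnergy A μ ν = ∫⁻ t in Ioi (0 : ℝ),
      ENNReal.ofReal ((gaussEnergy μ ν t - Real.exp (-(t * A ^ 2))) / (2 * t)) := by
  have hprod := ae_prod_abs_sub_le hS hμ hν
  have hnn : ∀ t ∈ Ioi (0 : ℝ), 0 ≤ᵐ[μ.prod ν] fun z : ℝ × ℝ =>
      (Real.exp (-(t * (z.1 - z.2) ^ 2)) - Real.exp (-(t * A ^ 2))) / (2 * t) := by
    intro t ht
    have ht0 : 0 < t := ht
    filter_upwards [hprod] with z hz
    have hsq : (z.1 - z.2) ^ 2 ≤ A ^ 2 := sq_le_sq' (abs_le.1 hz).1 (abs_le.1 hz).2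
    refine div_nonneg (sub_nonneg.2 (Real.exp_le_exp.2 (neg_le_neg ?_))) (by positivity)
    exact mul_le_mul_of_nonneg_left hsq ht0.le
  have hint : ∀ t ∈ Ioi (0 : ℝ), Integrable (fun z : ℝ × ℝ =>
      (Real.exp (-(t * (z.1 - z.2) ^ 2)) - Real.exp (-(t * A ^ 2))) / (2 * t)) (μ.prod ν) :=
    fun t ht => ((integrable_gauss μ ν (mem_Ioi.1 ht).le).sub (integrable_const _)).div_const _
  have hval : ∀ t ∈ Ioi (0 : ℝ), ∫ z : ℝ × ℝ,
      (Real.exp (-(t * (z.1 - z.2) ^ 2)) - Real.exp (-(t * A ^ 2))) / (2 * t) ∂(μ.prod ν) =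
      (gaussEnergy μ ν t - Real.exp (-(t * A ^ 2))) / (2 * t) := by
    intro t ht
    rw [integral_div, integral_sub (integrable_gauss μ ν (mem_Ioi.1 ht).le) (integrable_const _),
      integral_const, probReal_univ, one_smul, gaussEnergy]
  refine ⟨fun t ht => hval t ht ▸ integral_nonneg_of_ae (hnn t ht), ?_⟩
  have h1 : mutualEnergy A μ ν = ∫⁻ z : ℝ × ℝ, shiftedKernel A z.1 z.2 ∂(μ.prod ν) :=
    (lintegral_prod _ (measurable_shiftedKernel A).aemeasurable).symm
  have h2 : ∀ᵐ z ∂(μ.prod ν), shiftedKernel A z.1 z.2 = ∫⁻ t in Ioi (0 : ℝ),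
      ENNReal.ofReal ((Real.exp (-(t * (z.1 - z.2) ^ 2)) - Real.exp (-(t * A ^ 2))) / (2 * t)) := by
    filter_upwards [hprod] with z hz using shiftedKernel_eq_lintegral hA hz
  rw [h1, lintegral_congr_ae h2, lintegral_lintegral_swap]
  · refine setLIntegral_congr_fun measurableSet_Ioi fun t ht => ?_
    change ∫⁻ z : ℝ × ℝ, ENNReal.ofReal _ ∂_ = ENNReal.ofReal _
    rw [← ofReal_integral_eq_lintegral_ofReal (hint t ht) (hnn t ht), hval t ht]
  · exact (by fun_prop : Measurable fun z : (ℝ × ℝ) × ℝ => ENNReal.ofReal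
      ((Real.exp (-(z.2 * (z.1.1 - z.1.2) ^ 2)) - Real.exp (-(z.2 * A ^ 2))) /
        (2 * z.2))).aemeasurable

/-- Positive definiteness of the logarithmic energy on differences of probability measures of
finite energy. -/
theorem mutualEnergy_posDef {A : ℝ} (hA : 0 < A) {S : Set ℝ}
    (hS : ∀ x ∈ S, ∀ y ∈ S, |x - y| ≤ A) {μ ν : Measure ℝ} [IsProbabilityMeasure μ]
    [IsProbabilityMeasure ν] (hμ : μ Sᶜ = 0) (hν : ν Sᶜ = 0) (h1 : mutualEnergy A μ μ ≠ ⊤)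
    (h2 : mutualEnergy A ν ν ≠ ⊤) (h3 : mutualEnergy A μ ν ≠ ⊤) :
    2 * (mutualEnergy A μ ν).toReal ≤ (mutualEnergy A μ μ).toReal + (mutualEnergy A ν ν).toReal ∧
    ((mutualEnergy A μ μ).toReal + (mutualEnergy A ν ν).toReal ≤ 2 * (mutualEnergy A μ ν).toReal →
      μ = ν) := by
  have key : ∀ (μ ν : Measure ℝ) [IsProbabilityMeasure μ] [IsProbabilityMeasure ν], μ Sᶜ = 0 →
      ν Sᶜ = 0 → mutualEnergy A μ ν ≠ ⊤ →
      IntegrableOn (fun t => (gaussEnergy μ ν t - Real.exp (-(t * A ^ 2))) / (2 * t))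
        (Ioi (0 : ℝ)) ∧
      (mutualEnergy A μ ν).toReal =
        ∫ t in Ioi (0 : ℝ), (gaussEnergy μ ν t - Real.exp (-(t * A ^ 2))) / (2 * t) := by
    intro μ ν _ _ hμ hν hfin
    obtain ⟨hnn, heq⟩ := mutualEnergy_eq_lintegral hA hS hμ hν
    have hae : 0 ≤ᵐ[volume.restrict (Ioi (0 : ℝ))] fun t =>
        (gaussEnergy μ ν t - Real.exp (-(t * A ^ 2))) / (2 * t) := by
      filter_upwards [self_mem_ae_restrict measurableSet_Ioi] with t ht using hnn t ht
    have hm : AEStronglyMeasurable (fun t =>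
        (gaussEnergy μ ν t - Real.exp (-(t * A ^ 2))) / (2 * t))
        (volume.restrict (Ioi (0 : ℝ))) := by
      have hg : StronglyMeasurable (gaussEnergy μ ν) :=
        StronglyMeasurable.integral_prod_right (f := fun (t : ℝ) (z : ℝ × ℝ) =>
          Real.exp (-(t * (z.1 - z.2) ^ 2))) (by
            apply Continuous.stronglyMeasurable
            fun_prop)
      have hg' := hg.measurable
      exact (by fun_prop : Measurable fun t =>
        (gaussEnergy μ ν t - Real.exp (-(t * A ^ 2))) / (2 * t)).aestronglyMeasurable
    refine ⟨⟨hm, ?_⟩, ?_⟩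
    · rw [hasFiniteIntegral_iff_ofReal hae, ← heq]
      exact lt_top_iff_ne_top.2 hfin
    · rw [integral_eq_lintegral_of_nonneg_ae hae hm, heq]
  obtain ⟨i1, e1⟩ := key μ μ hμ hμ h1
  obtain ⟨i2, e2⟩ := key ν ν hν hν h2
  obtain ⟨i3, e3⟩ := key μ ν hμ hν h3
  set G : ℝ → ℝ := fun t =>
    (gaussEnergy μ μ t + gaussEnergy ν ν t - 2 * gaussEnergy μ ν t) / (2 * t) with hG
  have hGint : IntegrableOn G (Ioi (0 : ℝ)) := by
    have := (i1.add i2).sub (i3.const_mul 2)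
    refine this.congr (Eventually.of_forall fun t => ?_)
    simp only [hG, Pi.add_apply, Pi.sub_apply]
    ring
  have hGval : ∫ t in Ioi (0 : ℝ), G t = (mutualEnergy A μ μ).toReal +
      (mutualEnergy A ν ν).toReal - 2 * (mutualEnergy A μ ν).toReal := by
    rw [e1, e2, e3, ← integral_add_sub_two_mul i1 i2 i3]
    congr 1
    ext t
    simp only [hG]
    ring
  have hGnn : ∀ t ∈ Ioi (0 : ℝ), 0 ≤ G t := by
    intro t ht
    have ht0 : 0 < t := ht
    refine div_nonneg ?_ (by positivity)
    have := gaussEnergy_add_sub μ ν (2 * t).toNNReal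
    rw [Real.coe_toNNReal _ (by positivity), mul_div_cancel_left₀ _ two_ne_zero] at this
    rw [this]
    exact integral_nonneg fun s => by positivity
  refine ⟨?_, fun hle => ?_⟩
  · have := setIntegral_nonneg (μ := volume) measurableSet_Ioi hGnn
    linarith
  · have h0 : ∫ t in Ioi (0 : ℝ), G t = 0 :=
      le_antisymm (by linarith) (setIntegral_nonneg (μ := volume) measurableSet_Ioi hGnn)
    have hae : 0 ≤ᵐ[volume.restrict (Ioi (0 : ℝ))] G := by
      filter_upwards [self_mem_ae_restrict measurableSet_Ioi] with t ht using hGnn t ht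
    have hz := (integral_eq_zero_iff_of_nonneg_ae hae hGint).1 h0
    have : NeBot (ae (volume.restrict (Ioi (0 : ℝ)))) := by
      rw [ae_neBot, Ne, Measure.restrict_eq_zero, Real.volume_Ioi]
      exact ENNReal.top_ne_zero
    have hpos : ∀ᵐ t ∂(volume.restrict (Ioi (0 : ℝ))), t ∈ Ioi (0 : ℝ) :=
      self_mem_ae_restrict measurableSet_Ioi
    obtain ⟨t, ht, htz⟩ := (hpos.and hz).exists
    have ht0 : 0 < t := ht
    refine eq_of_gaussEnergy (v := (2 * t).toNNReal) (by simpa using ht0) ?_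
    rw [Real.coe_toNNReal _ (by positivity), mul_div_cancel_left₀ _ two_ne_zero]
    have : G t = 0 := htz
    exact (div_eq_zero_iff.1 this).resolve_right (by positivity)

end Energy

/-! ### A criterion for the equilibrium measure -/

section Equilibrium

open MeasureTheory ProbabilityTheory

theorem logKernel_self (x : ℝ) : logKernel x x = ⊤ := by
  simp [logKernel]

theorem logKernel_of_ne {x y : ℝ} (h : x ≠ y) :
    logKernel x y = ((-Real.log |x - y| : ℝ) : EReal) := by
  rw [logKernel, edist_dist, Real.dist_eq, ENNReal.log_ofReal_of_pos (abs_pos.2 (sub_ne_zero.2 h)),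
    EReal.coe_neg]

theorem measurable_logKernel : Measurable (Function.uncurry logKernel) :=
  (ENNReal.measurable_log.comp (measurable_fst.edist measurable_snd)).neg

theorem toENNReal_logKernel_add {A x y : ℝ} (hA : 1 ≤ A) (hxy : |x - y| ≤ A) :
    (logKernel x y).toENNReal + ENNReal.ofReal (Real.log A) =
      shiftedKernel A x y + (-logKernel x y).toENNReal := by
  by_cases h : x = y
  · subst h
    simp [logKernel_self, shiftedKernel]
  · have h0 : 0 < |x - y| := abs_pos.2 (sub_ne_zero.2 h)
    rw [logKernel_of_ne h, shiftedKernel, if_neg h, ← EReal.coe_neg, neg_neg,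
      EReal.real_coe_toENNReal, EReal.real_coe_toENNReal]
    have hl : Real.log |x - y| ≤ Real.log A := Real.log_le_log h0 hxy
    have hA0 : 0 ≤ Real.log A := Real.log_nonneg hA
    rcases le_total 0 (Real.log |x - y|) with h1 | h1
    · rw [ENNReal.ofReal_of_nonpos (neg_nonpos.2 h1), zero_add, ← ENNReal.ofReal_add (by linarith) h1]
      congr 1; ring
    · rw [ENNReal.ofReal_of_nonpos h1, add_zero, ← ENNReal.ofReal_add (by linarith) hA0]
      congr 1; ring

theorem toENNReal_neg_logKernel_le {A x y : ℝ} (hxy : |x - y| ≤ A) :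
    (-logKernel x y).toENNReal ≤ ENNReal.ofReal (Real.log A) := by
  by_cases h : x = y
  · subst h
    simp [logKernel_self]
  · rw [logKernel_of_ne h, ← EReal.coe_neg, neg_neg, EReal.real_coe_toENNReal]
    exact ENNReal.ofReal_le_ofReal (Real.log_le_log (abs_pos.2 (sub_ne_zero.2 h)) hxy)

/-- On a set of diameter at most `A`, the logarithmic energy is the energy of the nonnegative kernel
`log (A / |x - y|)` up to the constant `log A`. -/
theorem logEnergy_eq {A : ℝ} (hA : 1 ≤ A) {S : Set ℝ} (hS : ∀ x ∈ S, ∀ y ∈ S, |x - y| ≤ A)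
    {ν : Measure ℝ} [IsProbabilityMeasure ν] (hν : ν Sᶜ = 0) :
    logEnergy ν = (mutualEnergy A ν ν : EReal) - (Real.log A : EReal) := by
  have hA0 : 0 ≤ Real.log A := Real.log_nonneg hA
  have hprod := ae_prod_abs_sub_le hS hν hν
  set P := ∫⁻ x, ∫⁻ y, (logKernel x y).toENNReal ∂ν ∂ν with hP
  set N := ∫⁻ x, ∫⁻ y, (-logKernel x y).toENNReal ∂ν ∂ν with hN
  have hmP : Measurable fun z : ℝ × ℝ => (logKernel z.1 z.2).toENNReal :=
    measurable_logKernel.ereal_toENNReal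
  have hmN : Measurable fun z : ℝ × ℝ => (-logKernel z.1 z.2).toENNReal :=
    measurable_logKernel.neg.ereal_toENNReal
  have hmJ : Measurable fun z : ℝ × ℝ => shiftedKernel A z.1 z.2 := measurable_shiftedKernel A
  have eP : P = ∫⁻ z : ℝ × ℝ, (logKernel z.1 z.2).toENNReal ∂(ν.prod ν) :=
    (lintegral_prod _ hmP.aemeasurable).symm
  have eN : N = ∫⁻ z : ℝ × ℝ, (-logKernel z.1 z.2).toENNReal ∂(ν.prod ν) :=
    (lintegral_prod _ hmN.aemeasurable).symm
  have eJ : mutualEnergy A ν ν = ∫⁻ z : ℝ × ℝ, shiftedKernel A z.1 z.2 ∂(ν.prod ν) :=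
    (lintegral_prod _ hmJ.aemeasurable).symm
  have eA : ENNReal.ofReal (Real.log A) =
      ∫⁻ _ : ℝ × ℝ, ENNReal.ofReal (Real.log A) ∂(ν.prod ν) := by simp
  have hsum : P + ENNReal.ofReal (Real.log A) = mutualEnergy A ν ν + N := by
    rw [eP, eN, eJ, eA, ← lintegral_add_left hmP, ← lintegral_add_left hmJ]
    refine lintegral_congr_ae ?_
    filter_upwards [hprod] with z hz using toENNReal_logKernel_add hA hz
  have hNle : N ≤ ENNReal.ofReal (Real.log A) := by
    rw [eN, eA]
    refine lintegral_mono_ae ?_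
    filter_upwards [hprod] with z hz using toENNReal_neg_logKernel_le hz
  have hNtop : N ≠ ⊤ := ne_top_of_le_ne_top ENNReal.ofReal_ne_top hNle
  rw [logEnergy, ← hP, ← hN]
  by_cases hJ : mutualEnergy A ν ν = ⊤
  · have hPtop : P = ⊤ := by
      rw [hJ, top_add] at hsum
      exact (ENNReal.add_eq_top.1 hsum).resolve_right ENNReal.ofReal_ne_top
    rw [hJ, hPtop, EReal.coe_ennreal_top, ← EReal.coe_ennreal_toReal hNtop]
    exact (EReal.top_sub_coe _).trans (EReal.top_sub_coe _).symm
  · have hPtop : P ≠ ⊤ := by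
      intro h
      rw [h, top_add] at hsum
      exact ENNReal.add_ne_top.2 ⟨hJ, hNtop⟩ hsum.symm
    have h := congrArg ENNReal.toReal hsum
    rw [ENNReal.toReal_add hPtop ENNReal.ofReal_ne_top, ENNReal.toReal_add hJ hNtop,
      ENNReal.toReal_ofReal hA0] at h
    rw [← EReal.coe_ennreal_toReal hPtop, ← EReal.coe_ennreal_toReal hNtop,
      ← EReal.coe_ennreal_toReal hJ, ← EReal.coe_sub, ← EReal.coe_sub]
    congr 1
    linarith

/-- A probability measure on a bounded set whose logarithmic potential is finite and constant
on the set is the unique equilibrium measure of the set. -/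
theorem equilibriumMeasure_eq {A : ℝ} (hA : 1 ≤ A) {S : Set ℝ}
    (hS : ∀ x ∈ S, ∀ y ∈ S, |x - y| ≤ A) {μ : Measure ℝ} [IsProbabilityMeasure μ] (hμ : μ Sᶜ = 0)
    {c : ENNReal} (hc : c ≠ ⊤) (hpot : ∀ x ∈ S, ∫⁻ y, shiftedKernel A x y ∂μ = c) :
    equilibriumMeasure S = μ := by
  have hA0 : 0 < A := by linarith
  have hcross : ∀ ν : Measure ℝ, IsProbabilityMeasure ν → ν Sᶜ = 0 → mutualEnergy A ν μ = c := by
    intro ν _ hν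
    have hν' : ∀ᵐ x ∂ν, x ∈ S := hν
    have : ∀ᵐ x ∂ν, ∫⁻ y, shiftedKernel A x y ∂μ = c := by
      filter_upwards [hν'] with x hx using hpot x hx
    rw [mutualEnergy, lintegral_congr_ae this]
    simp
  have hμμ := hcross μ inferInstance hμ
  have hlt : logEnergy μ < ⊤ := by
    rw [logEnergy_eq hA hS hμ, hμμ, ← EReal.coe_ennreal_toReal hc, ← EReal.coe_sub]
    exact EReal.coe_lt_top _
  have hle : ∀ ν : Measure ℝ, IsProbabilityMeasure ν → ν Sᶜ = 0 → logEnergy μ ≤ logEnergy ν := by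
    intro ν _ hν
    rw [logEnergy_eq hA hS hμ, logEnergy_eq hA hS hν]
    refine EReal.sub_le_sub ?_ le_rfl
    rw [EReal.coe_ennreal_le_coe_ennreal_iff]
    by_cases hνν : mutualEnergy A ν ν = ⊤
    · rw [hνν]; exact le_top
    have h := (mutualEnergy_posDef hA0 hS hν hμ hνν (hμμ.trans_ne hc)
      ((hcross ν inferInstance hν).trans_ne hc)).1
    rw [hcross ν inferInstance hν, hμμ] at h
    rw [hμμ, ← ENNReal.toReal_le_toReal hc hνν]
    linarith
  have hex : ∃ ν : Measure ℝ, IsEquilibriumMeasure S ν := ⟨μ, inferInstance, hμ, hlt, hle⟩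
  rw [equilibriumMeasure, dif_pos hex]
  obtain ⟨hprob, hν, hνlt, hνle⟩ := hex.choose_spec
  set ν := hex.choose
  have h1 := hνle μ inferInstance hμ
  rw [logEnergy_eq hA hS hμ, logEnergy_eq hA hS hν] at h1
  have hνν : mutualEnergy A ν ν ≠ ⊤ := by
    intro h
    rw [logEnergy_eq hA hS hν, h, EReal.coe_ennreal_top, EReal.top_sub_coe] at hνlt
    exact lt_irrefl _ hνlt
  refine (mutualEnergy_posDef hA0 hS hν hμ hνν (hμμ.trans_ne hc)
      ((hcross ν inferInstance hν).trans_ne hc)).2 ?_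
  rw [hcross ν inferInstance hν, hμμ]
  rw [hμμ, ← EReal.coe_ennreal_toReal hc, ← EReal.coe_ennreal_toReal hνν, ← EReal.coe_sub,
    ← EReal.coe_sub, EReal.coe_le_coe_iff] at h1
  linarith

end Equilibrium

/-! ### The equilibrium measure of the bands -/

section ArcsinePotential

open MeasureTheory ProbabilityTheory

theorem norm_circleMap_sub_mul_norm_circleMap_sub (α θ : ℝ) :
    ‖circleMap 0 1 θ - Complex.exp (α * Complex.I)‖ *
      ‖circleMap 0 1 θ - Complex.exp (-(α * Complex.I))‖ = |2 * Real.cos α - 2 * Real.cos θ| := by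
  have h : (circleMap 0 1 θ - Complex.exp (α * Complex.I)) *
      (circleMap 0 1 θ - Complex.exp (-(α * Complex.I))) =
      Complex.exp (θ * Complex.I) * ((2 * Real.cos θ - 2 * Real.cos α : ℝ) : ℂ) := by
    have h1 : Complex.exp (α * Complex.I) * Complex.exp (-(α * Complex.I)) = 1 := by
      rw [← Complex.exp_add, add_neg_cancel, Complex.exp_zero]
    have h2 : Complex.exp (θ * Complex.I) * Complex.exp (-(θ * Complex.I)) = 1 := by
      rw [← Complex.exp_add, add_neg_cancel, Complex.exp_zero]
    simp only [circleMap, zero_add, Complex.ofReal_one, one_mul]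
    push_cast [Complex.cos]
    rw [neg_mul, neg_mul]
    linear_combination h1 - h2
  rw [← norm_mul, h, norm_mul, Complex.norm_exp_ofReal_mul_I, one_mul, Complex.norm_real,
    Real.norm_eq_abs, abs_sub_comm]

/-- The logarithmic potential of the arcsine measure vanishes on `[-2, 2]`: by the factorization of
`2 cos α - 2 cos θ` it is a sum of two averages of `log |e^{iθ} - e^{±iα}|` over the circle. -/
theorem integral_log_abs_cos_sub_cos (α : ℝ) :
    IntervalIntegrable (fun θ => Real.log |2 * Real.cos α - 2 * Real.cos θ|) volume 0 Real.pi ∧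
      ∫ θ in (0)..Real.pi, Real.log |2 * Real.cos α - 2 * Real.cos θ| = 0 := by
  set f : ℝ → ℝ := fun θ => Real.log |2 * Real.cos α - 2 * Real.cos θ| with hf
  set g : ℂ → ℝ → ℝ := fun u θ => Real.log ‖circleMap 0 1 θ - u‖ with hg
  have hgi : ∀ u : ℂ, IntervalIntegrable (g u) volume 0 (2 * Real.pi) := fun u =>
    circleIntegrable_log_norm_sub_const (a := u) (c := 0) 1
  have hg0 : ∀ u : ℂ, ‖u‖ = 1 → ∫ θ in (0)..(2 * Real.pi), g u θ = 0 := by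
    intro u hu
    have h := circleAverage_log_norm_sub_const_of_mem_closedBall (a := u) (c := 0) (R := 1)
      (by simp [hu])
    rw [Real.circleAverage_def, Real.log_one, smul_eq_mul] at h
    exact (mul_eq_zero.1 h).resolve_left (by positivity)
  set u := Complex.exp (α * Complex.I) with hu
  set v := Complex.exp (-(α * Complex.I)) with hv
  have hu1 : ‖u‖ = 1 := Complex.norm_exp_ofReal_mul_I α
  have hv1 : ‖v‖ = 1 := by
    have := Complex.norm_exp_ofReal_mul_I (-α)
    rwa [Complex.ofReal_neg, neg_mul] at this
  have hae : ∀ᵐ θ : ℝ, g u θ + g v θ = f θ := by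
    have hcount : (circleMap 0 1 ⁻¹' {u, v}).Countable :=
      (Set.toFinite {u, v}).countable.preimage_circleMap 0 one_ne_zero
    filter_upwards [hcount.ae_notMem volume] with θ hθ
    simp only [mem_preimage, mem_insert_iff, mem_singleton_iff, not_or] at hθ
    simp only [hf, hg]
    rw [← norm_circleMap_sub_mul_norm_circleMap_sub, Real.log_mul
      (norm_ne_zero_iff.2 (sub_ne_zero.2 hθ.1)) (norm_ne_zero_iff.2 (sub_ne_zero.2 hθ.2))]
  have hfi : IntervalIntegrable f volume 0 (2 * Real.pi) :=
    ((hgi u).add (hgi v)).congr_ae (ae_restrict_of_ae hae)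
  have hf0 : ∫ θ in (0)..(2 * Real.pi), f θ = 0 := by
    rw [← intervalIntegral.integral_congr_ae (hae.mono fun θ h _ => h),
      intervalIntegral.integral_add (hgi u) (hgi v), hg0 u hu1, hg0 v hv1, add_zero]
  have hpi := Real.pi_pos
  have h1 : IntervalIntegrable f volume 0 Real.pi := hfi.mono_set (by
    rw [uIcc_of_le hpi.le, uIcc_of_le (by linarith)]
    exact Icc_subset_Icc le_rfl (by linarith))
  have h2 : IntervalIntegrable f volume Real.pi (2 * Real.pi) := hfi.mono_set (by
    rw [uIcc_of_le (by linarith), uIcc_of_le (by linarith)]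
    exact Icc_subset_Icc hpi.le le_rfl)
  refine ⟨h1, ?_⟩
  have hsymm : ∫ θ in Real.pi..(2 * Real.pi), f θ = ∫ θ in (0)..Real.pi, f θ := by
    have h := intervalIntegral.integral_comp_sub_left f (a := 0) (b := Real.pi) (2 * Real.pi)
    rw [sub_zero, show 2 * Real.pi - Real.pi = Real.pi by ring] at h
    rw [← h]
    refine intervalIntegral.integral_congr fun θ _ => ?_
    simp only [hf, Real.cos_two_pi_sub]
  have := intervalIntegral.integral_add_adjacent_intervals h1 h2
  rw [hf0, hsymm] at this
  linarith

end ArcsinePotential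

section BandMeasure

open MeasureTheory ProbabilityTheory

variable {a b : ℕ → ℝ} {p : ℕ}

/-- The pullback of the arcsine measure under `Δ`, normalized: each band has mass `1 / p`, on which
the angle `θ` with `Δ = 2 cos θ` is uniformly distributed. -/
def bandMeasure (p : ℕ) (Y : Fin p → ℝ → ℝ) : Measure ℝ :=
  (ENNReal.ofReal (p * Real.pi))⁻¹ • ∑ j, (volume.restrict (Icc 0 Real.pi)).map (Y j)

theorem bandMeasure_apply {Y : Fin p → ℝ → ℝ} (hY : ∀ j, Continuous (Y j)) {s : Set ℝ}
    (hs : MeasurableSet s) : bandMeasure p Y s =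
      (ENNReal.ofReal (p * Real.pi))⁻¹ * ∑ j, volume (Y j ⁻¹' s ∩ Icc 0 Real.pi) := by
  simp only [bandMeasure, Measure.smul_apply, smul_eq_mul, Measure.finsetSum_apply]
  congr 1
  refine Finset.sum_congr rfl fun j _ => ?_
  rw [Measure.map_apply (hY j).measurable hs, Measure.restrict_apply ((hY j).measurable hs)]

theorem isProbabilityMeasure_bandMeasure (hp : 1 ≤ p) {Y : Fin p → ℝ → ℝ}
    (hY : ∀ j, Continuous (Y j)) : IsProbabilityMeasure (bandMeasure p Y) := by
  constructor
  have hp0 : (0 : ℝ) < p := by exact_mod_cast hp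
  have hpos : 0 < p * Real.pi := mul_pos hp0 Real.pi_pos
  rw [bandMeasure_apply hY MeasurableSet.univ]
  simp only [preimage_univ, univ_inter, Real.volume_Icc, sub_zero, Finset.sum_const,
    Finset.card_univ, Fintype.card_fin, nsmul_eq_mul]
  rw [← ENNReal.ofReal_natCast, ← ENNReal.ofReal_mul hp0.le]
  exact ENNReal.inv_mul_cancel (ENNReal.ofReal_pos.2 hpos).ne' ENNReal.ofReal_ne_top

/-- For `c` strictly between `-2` and `2`, the polynomial `Δ - c` has one root in each band. -/
theorem discriminant_sub_eq_prod (hp : 1 ≤ p) (ha : ∀ n, 0 < a n) (hap : ∀ n, a (n + p) = a n)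
    {Y : Fin p → ℝ → ℝ}
    (hY : ∀ j : Fin p, IsBandParam (discriminant a b p) (bandLeft a b p j) (bandRight a b p j) (Y j))
    {θ : ℝ} (hθ : θ ∈ Ioo 0 Real.pi) (x : ℝ) :
    (discriminant a b p).eval x - 2 * Real.cos θ =
      (discriminant a b p).leadingCoeff * ∏ j, (x - Y j θ) := by
  set D := discriminant a b p with hD
  set F := D - C (2 * Real.cos θ) with hF
  have hdeg : F.natDegree = p := by rw [hF, natDegree_sub_C, natDegree_discriminant ha hp]
  have hlead : F.leadingCoeff = D.leadingCoeff := by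
    rw [leadingCoeff, hdeg, leadingCoeff, natDegree_discriminant ha hp, hF, coeff_sub,
      coeff_C_of_ne_zero (by omega), sub_zero]
  have hF0 : F ≠ 0 := by
    intro h; rw [h, natDegree_zero] at hdeg; omega
  have hmono : StrictMono fun j => Y j θ := by
    intro i j hij
    have h1 := ((hY i).mem_Ioo_iff (Ioo_subset_Icc_self hθ)).2 hθ
    have h2 := ((hY j).mem_Ioo_iff (Ioo_subset_Icc_self hθ)).2 hθ
    exact h1.2.trans_le ((bandRight_le_bandLeft hp ha hap hij).trans h2.1.le)
  have hroots : Finset.univ.val.map (fun j => Y j θ) = F.roots := by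
    refine Multiset.eq_of_le_of_card_le ?_ ?_
    · rw [Multiset.le_iff_subset (Finset.univ.nodup.map hmono.injective)]
      intro y hy
      obtain ⟨j, -, rfl⟩ := Multiset.mem_map.1 hy
      rw [mem_roots hF0, IsRoot.def, hF, eval_sub, eval_C, (hY j).eval_eq, sub_self]
    · rw [Multiset.card_map]
      refine (card_roots' F).trans ?_
      rw [hdeg]
      simp
  have hcard : F.roots.card = F.natDegree := by
    rw [← hroots, hdeg, Multiset.card_map]; simp
  have h := congrArg (eval x) (C_leadingCoeff_mul_prod_multiset_X_sub_C hcard)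
  rw [← hroots, Multiset.map_map, eval_mul, eval_C, hlead, eval_multiset_prod, Multiset.map_map,
    hF, eval_sub, eval_C] at h
  rw [← h]
  congr 1
  rw [Finset.prod_eq_multiset_prod]
  congr 1
  refine Multiset.map_congr rfl fun j _ => ?_
  simp

theorem mem_bands_iff {x : ℝ} :
    x ∈ bands a b p ↔ ∃ j : Fin p, x ∈ Icc (bandLeft a b p j) (bandRight a b p j) := by
  simp [bands]

/-- The potential of `bandMeasure` is constant on the bands. -/
theorem lintegral_shiftedKernel_bandMeasure (hp : 1 ≤ p) (ha : ∀ n, 0 < a n)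
    (hap : ∀ n, a (n + p) = a n) {Y : Fin p → ℝ → ℝ}
    (hY : ∀ j : Fin p, IsBandParam (discriminant a b p) (bandLeft a b p j) (bandRight a b p j) (Y j))
    {A : ℝ} (hA : ∀ x ∈ bands a b p, ∀ y ∈ bands a b p, |x - y| ≤ A) {x : ℝ}
    (hx : x ∈ bands a b p) :
    ∫⁻ y, shiftedKernel A x y ∂(bandMeasure p Y) = (ENNReal.ofReal (p * Real.pi))⁻¹ *
      ENNReal.ofReal (Real.pi *
        (p * Real.log A + Real.log (discriminant a b p).leadingCoeff)) := by
  set D := discriminant a b p with hD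
  have hpi := Real.pi_pos
  have hlead : 0 < D.leadingCoeff := by
    rw [leadingCoeff, natDegree_discriminant ha hp]; exact coeff_discriminant_pos ha hp
  have hmeas : ∀ j, Measurable fun θ => shiftedKernel A x (Y j θ) := fun j =>
    (measurable_shiftedKernel A).comp (measurable_const.prodMk (hY j).continuous.measurable)
  have h1 : ∫⁻ y, shiftedKernel A x y ∂(bandMeasure p Y) = (ENNReal.ofReal (p * Real.pi))⁻¹ *
      ∫⁻ θ in Icc 0 Real.pi, ∑ j, shiftedKernel A x (Y j θ) := by
    rw [bandMeasure, lintegral_smul_measure, smul_eq_mul, lintegral_finsetSum_measure,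
      lintegral_finsetSum _ fun j _ => hmeas j]
    congr 1
    refine Finset.sum_congr rfl fun j _ => ?_
    exact lintegral_map ((measurable_shiftedKernel A).comp measurable_prodMk_left)
      (hY j).continuous.measurable
  -- the angle of `x`
  have hxD : |D.eval x| ≤ 2 := by
    obtain ⟨j, hj⟩ := mem_bands_iff.1 hx
    exact (hY j).isBand.abs_le hj
  obtain ⟨α, hα⟩ : ∃ α : ℝ, 2 * Real.cos α = D.eval x := by
    have := abs_le.1 hxD
    exact ⟨Real.arccos (D.eval x / 2), by
      rw [Real.cos_arccos (by linarith) (by linarith)]; ring⟩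
  obtain ⟨hint, hint0⟩ := integral_log_abs_cos_sub_cos α
  set F : ℝ → ℝ := fun θ => (p * Real.log A + Real.log D.leadingCoeff) -
    Real.log |2 * Real.cos α - 2 * Real.cos θ| with hF
  have hae : ∀ᵐ θ ∂(volume.restrict (Icc 0 Real.pi)),
      0 ≤ F θ ∧ ∑ j, shiftedKernel A x (Y j θ) = ENNReal.ofReal (F θ) := by
    have hcount : (circleMap 0 1 ⁻¹' {Complex.exp (α * Complex.I),
        Complex.exp (-(α * Complex.I))}).Countable :=
      (Set.toFinite _).countable.preimage_circleMap 0 one_ne_zero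
    have hmem : ∀ᵐ θ ∂(volume.restrict (Icc 0 Real.pi)), θ ∈ Ioo 0 Real.pi := by
      rw [← Measure.restrict_congr_set Ioo_ae_eq_Icc]
      exact self_mem_ae_restrict measurableSet_Ioo
    filter_upwards [ae_restrict_of_ae (hcount.ae_notMem volume), hmem] with θ hθ hθπ
    simp only [mem_preimage, mem_insert_iff, mem_singleton_iff, not_or] at hθ
    have hne : 2 * Real.cos α - 2 * Real.cos θ ≠ 0 := by
      rw [← abs_ne_zero, ← norm_circleMap_sub_mul_norm_circleMap_sub]
      exact mul_ne_zero (norm_ne_zero_iff.2 (sub_ne_zero.2 hθ.1))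
        (norm_ne_zero_iff.2 (sub_ne_zero.2 hθ.2))
    have hprod := discriminant_sub_eq_prod hp ha hap hY hθπ x
    rw [← hD, ← hα] at hprod
    have hxY : ∀ j, x - Y j θ ≠ 0 := by
      intro j h0
      rw [Finset.prod_eq_zero (Finset.mem_univ j) h0, mul_zero] at hprod
      exact hne hprod
    have hle : ∀ j, Real.log |x - Y j θ| ≤ Real.log A := fun j =>
      Real.log_le_log (abs_pos.2 (hxY j)) (hA x hx _ (mem_bands_iff.2 ⟨j, (hY j).mem θ⟩))
    have hsum : F θ = ∑ j, (Real.log A - Real.log |x - Y j θ|) := by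
      rw [hF]
      simp only
      rw [hprod, abs_mul, Finset.abs_prod, abs_of_pos hlead, Real.log_mul hlead.ne'
        (Finset.prod_ne_zero_iff.2 fun j _ => abs_ne_zero.2 (hxY j)),
        Real.log_prod fun j _ => abs_ne_zero.2 (hxY j), Finset.sum_sub_distrib, Finset.sum_const,
        Finset.card_univ, Fintype.card_fin, nsmul_eq_mul]
      ring
    refine ⟨hsum ▸ Finset.sum_nonneg fun j _ => sub_nonneg.2 (hle j), ?_⟩
    rw [hsum, ENNReal.ofReal_sum_of_nonneg fun j _ => sub_nonneg.2 (hle j)]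
    refine Finset.sum_congr rfl fun j _ => ?_
    rw [shiftedKernel, if_neg (sub_ne_zero.1 (hxY j))]
  have hFint : IntervalIntegrable F volume 0 Real.pi := intervalIntegrable_const.sub hint
  have hval : ∫ θ in Icc 0 Real.pi, F θ =
      Real.pi * (p * Real.log A + Real.log D.leadingCoeff) := by
    rw [integral_Icc_eq_integral_Ioc, ← intervalIntegral.integral_of_le hpi.le, hF,
      intervalIntegral.integral_sub intervalIntegrable_const hint, hint0,
      intervalIntegral.integral_const, sub_zero, sub_zero, smul_eq_mul]
  rw [h1, lintegral_congr_ae (hae.mono fun θ h => h.2), ← hval, ofReal_integral_eq_lintegral_ofReal]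
  · rw [← IntegrableOn, integrableOn_Icc_iff_integrableOn_Ioc]
    exact (intervalIntegrable_iff_integrableOn_Ioc_of_le hpi.le).1 hFint
  · exact hae.mono fun θ h => h.1

/-- The equilibrium measure of the bands is the pullback of the arcsine measure. -/
theorem equilibriumMeasure_bands (hp : 1 ≤ p) (ha : ∀ n, 0 < a n)
    (hap : ∀ n, a (n + p) = a n) {Y : Fin p → ℝ → ℝ}
    (hY : ∀ j : Fin p, IsBandParam (discriminant a b p) (bandLeft a b p j) (bandRight a b p j) (Y j)) :
    equilibriumMeasure (bands a b p) = bandMeasure p Y := by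
  have hcompact : IsCompact (bands a b p) := isCompact_iUnion fun _ => isCompact_Icc
  obtain ⟨A, hA⟩ := Metric.isBounded_iff.1 hcompact.isBounded
  have hA' : ∀ x ∈ bands a b p, ∀ y ∈ bands a b p, |x - y| ≤ max A 1 := fun x hx y hy =>
    (hA hx hy).trans (le_max_left _ _)
  have hcont := fun j => (hY j).continuous
  have := isProbabilityMeasure_bandMeasure hp hcont
  refine equilibriumMeasure_eq (le_max_right A 1) hA' ?_ ?_
    fun x hx => lintegral_shiftedKernel_bandMeasure hp ha hap hY hA' hx
  · rw [bandMeasure_apply hcont hcompact.isClosed.measurableSet.compl]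
    refine mul_eq_zero_of_right _ (Finset.sum_eq_zero fun j _ => ?_)
    have : Y j ⁻¹' (bands a b p)ᶜ = ∅ := by
      refine eq_empty_of_forall_notMem fun θ hθ => hθ (mem_bands_iff.2 ⟨j, (hY j).mem θ⟩)
    rw [this, empty_inter, measure_empty]
  · have hp0 : (0 : ℝ) < p := by exact_mod_cast hp
    refine ENNReal.mul_ne_top (ENNReal.inv_ne_top.2 ?_) ENNReal.ofReal_ne_top
    exact (ENNReal.ofReal_pos.2 (mul_pos hp0 Real.pi_pos)).ne'

/-- On a band, `p π k` differs from the angle `θ` by a constant and, possibly, a sign. -/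
theorem equilibriumCDF_sub (hp : 1 ≤ p) (ha : ∀ n, 0 < a n)
    (hap : ∀ n, a (n + p) = a n) {Y : Fin p → ℝ → ℝ}
    (hY : ∀ j : Fin p, IsBandParam (discriminant a b p) (bandLeft a b p j) (bandRight a b p j) (Y j))
    (j : Fin p) {θ θ' : ℝ} (hθ : θ ∈ Icc 0 Real.pi) (hθ' : θ' ∈ Icc 0 Real.pi)
    (hlt : Y j θ < Y j θ') :
    equilibriumCDF a b p (Y j θ') - equilibriumCDF a b p (Y j θ) = |θ' - θ| / (p * Real.pi) := by
  have hp0 : (0 : ℝ) < p := by exact_mod_cast hp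
  have hpos : 0 < p * Real.pi := mul_pos hp0 Real.pi_pos
  have hcont := fun j => (hY j).continuous
  have := isProbabilityMeasure_bandMeasure hp hcont
  have hleft : bandLeft a b p 0 ≤ Y j θ := by
    refine le_trans ?_ ((hY j).mem θ).1
    rcases (Nat.zero_le (j : ℕ)).eq_or_lt with h | h
    · rw [← h]
    · have h0 : (⟨0, hp⟩ : Fin p) < j := h
      exact (hY ⟨0, hp⟩).isBand.lt.le.trans (bandRight_le_bandLeft hp ha hap h0)
  have hdiff : Icc (bandLeft a b p 0) (Y j θ') =
      Icc (bandLeft a b p 0) (Y j θ) ∪ Ioc (Y j θ) (Y j θ') :=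
    (Icc_union_Ioc_eq_Icc hleft hlt.le).symm
  have hdisj : Disjoint (Icc (bandLeft a b p 0) (Y j θ)) (Ioc (Y j θ) (Y j θ')) := by
    rw [Set.disjoint_left]
    exact fun z h1 h2 => h2.1.not_ge h1.2
  rw [equilibriumCDF, equilibriumCDF, equilibriumMeasure_bands hp ha hap hY, hdiff,
    measureReal_union hdisj measurableSet_Ioc, add_sub_cancel_left, measureReal_def,
    bandMeasure_apply hcont measurableSet_Ioc, Finset.sum_eq_single j]
  · have hvol : volume (Y j ⁻¹' Ioc (Y j θ) (Y j θ') ∩ Icc 0 Real.pi) =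
        ENNReal.ofReal |θ' - θ| := by
      rcases (hY j).strictMonoOn_or_strictAntiOn with hm | hm
      · have hθθ : θ < θ' := (hm.lt_iff_lt hθ hθ').1 hlt
        have : Y j ⁻¹' Ioc (Y j θ) (Y j θ') ∩ Icc 0 Real.pi = Ioc θ θ' := by
          ext t
          constructor
          · rintro ⟨⟨h1, h2⟩, ht⟩
            exact ⟨(hm.lt_iff_lt hθ ht).1 h1, (hm.le_iff_le ht hθ').1 h2⟩
          · rintro ⟨h1, h2⟩
            have ht : t ∈ Icc 0 Real.pi := ⟨hθ.1.trans h1.le, h2.trans hθ'.2⟩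
            exact ⟨⟨(hm.lt_iff_lt hθ ht).2 h1, (hm.le_iff_le ht hθ').2 h2⟩, ht⟩
        rw [this, Real.volume_Ioc, abs_of_pos (sub_pos.2 hθθ)]
      · have hθθ : θ' < θ := (hm.lt_iff_gt hθ hθ').1 hlt
        have : Y j ⁻¹' Ioc (Y j θ) (Y j θ') ∩ Icc 0 Real.pi = Ico θ' θ := by
          ext t
          constructor
          · rintro ⟨⟨h1, h2⟩, ht⟩
            exact ⟨(hm.le_iff_ge ht hθ').1 h2, (hm.lt_iff_gt hθ ht).1 h1⟩
          · rintro ⟨h1, h2⟩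
            have ht : t ∈ Icc 0 Real.pi := ⟨hθ'.1.trans h1, h2.le.trans hθ.2⟩
            exact ⟨⟨(hm.lt_iff_gt hθ ht).2 h2, (hm.le_iff_ge ht hθ').2 h1⟩, ht⟩
        rw [this, Real.volume_Ico, abs_sub_comm, abs_of_pos (sub_pos.2 hθθ)]
    rw [hvol, ENNReal.toReal_mul, ENNReal.toReal_inv, ENNReal.toReal_ofReal hpos.le,
      ENNReal.toReal_ofReal (abs_nonneg _)]
    ring
  · -- the other bands meet `(Y j θ, Y j θ']` at most in an edge
    intro i _ hij
    refine measure_mono_null (t := {0, Real.pi}) ?_ ((Set.toFinite _).measure_zero _)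
    rintro t ⟨⟨h1, h2⟩, ht⟩
    by_contra hne
    simp only [mem_insert_iff, mem_singleton_iff, not_or] at hne
    have htI : t ∈ Ioo 0 Real.pi := ⟨lt_of_le_of_ne ht.1 (Ne.symm hne.1), lt_of_le_of_ne ht.2 hne.2⟩
    have hmem := ((hY i).mem_Ioo_iff ht).2 htI
    rcases lt_or_gt_of_ne hij with h | h
    · have := bandRight_le_bandLeft (b := b) hp ha hap h
      have := ((hY j).mem θ).1
      linarith [hmem.2]
    · have := bandRight_le_bandLeft (b := b) hp ha hap h
      have := ((hY j).mem θ').2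
      linarith [hmem.1]
  · exact fun h => absurd (Finset.mem_univ j) h

end BandMeasure

/-! ### Counting and spacing of the zeros of the orthonormal polynomials -/

section Clock

variable {a b : ℕ → ℝ} {p : ℕ}

theorem exists_bandParam (hp : 1 ≤ p) (ha : ∀ n, 0 < a n) (hap : ∀ n, a (n + p) = a n) :
    ∃ Y : Fin p → ℝ → ℝ, ∀ j : Fin p,
      IsBandParam (discriminant a b p) (bandLeft a b p j) (bandRight a b p j) (Y j) := by
  choose Y hY using fun j => (isBand_bandLeft_bandRight (b := b) hp ha hap j).exists_param
  exact ⟨Y, hY⟩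

theorem isFloquetSequence_orthoPoly (hp : 1 ≤ p) (ha : ∀ n, 0 < a n) (hap : ∀ n, a (n + p) = a n)
    (hbp : ∀ n, b (n + p) = b n) (r : ℕ) (j : Fin p) :
    IsFloquetSequence (discriminant a b p) (bandLeft a b p j) (bandRight a b p j)
      (fun m => orthoPoly a b (r + m * p)) where
  recurrence m := by
    have := orthoPoly_add_two_periods ha hap hbp (r + m * p)
    rw [show r + (m + 2) * p = r + m * p + p + p by ring,
      show r + (m + 1) * p = r + m * p + p by ring]
    exact this
  critical x := discriminant_critical hp ha hap
  interior x hx h0 h1 := by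
    simp only [zero_mul, add_zero, one_mul] at h0 h1
    exact absurd ((isBand_bandLeft_bandRight (b := b) hp ha hap j).abs_lt x hx)
      (not_lt.2 (two_le_abs_discriminant_of_common_zero ha hap hbp h0 h1))
  edge x s hs hx h0 h1 := by
    simp only [zero_mul, add_zero, one_mul] at h0 h1 ⊢
    exact derivative_ne_of_common_zero hp ha hap hbp h0 h1 hs hx

variable {I : Fin p → Set ℝ}

/-- Along a residue class, the number of zeros in a band is eventually `m` plus a constant. -/
theorem exists_ncard_zerosIn (hp : 1 ≤ p) (ha : ∀ n, 0 < a n) (hap : ∀ n, a (n + p) = a n)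
    (hbp : ∀ n, b (n + p) = b n)
    (hI : (∀ j : Fin p, I j = Icc (bandLeft a b p j) (bandRight a b p j)) ∨
      (∀ j : Fin p, I j = Ioo (bandLeft a b p j) (bandRight a b p j)))
    (r : ℕ) (j : Fin p) :
    ∃ d : ℤ, ∀ᶠ m : ℕ in atTop, ((zerosIn a b (r + m * p) (I j)).ncard : ℤ) = m - d := by
  obtain ⟨Y, hY⟩ := exists_bandParam (b := b) hp ha hap
  have hq := isFloquetSequence_orthoPoly hp ha hap hbp r j
  rcases hI with hI | hI
  · rw [hI j]
    exact hq.exists_ncard_Icc (hY j)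
  · rw [hI j]
    obtain ⟨d, hd⟩ := hq.exists_ncard_Ioo (hY j)
    exact ⟨d, hd.mono fun m h => h.2⟩

theorem bddAbove_ncard_zerosIn (hp : 1 ≤ p) (ha : ∀ n, 0 < a n) (hap : ∀ n, a (n + p) = a n)
    (hbp : ∀ n, b (n + p) = b n)
    (hI : (∀ j : Fin p, I j = Icc (bandLeft a b p j) (bandRight a b p j)) ∨
      (∀ j : Fin p, I j = Ioo (bandLeft a b p j) (bandRight a b p j))) :
    BddAbove (Set.range fun q : ℕ × Fin p =>
      |(q.1 : ℝ) / (p : ℝ) - ((zerosIn a b q.1 (I q.2)).ncard : ℝ)|) := by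
  have hp0 : (0 : ℝ) < p := by exact_mod_cast hp
  have hclass : ∀ rj : Fin p × Fin p, ∃ C : ℝ, ∀ m : ℕ,
      |((rj.1 + m * p : ℕ) : ℝ) / p - (zerosIn a b (rj.1 + m * p) (I rj.2)).ncard| ≤ C := by
    rintro ⟨r, j⟩
    obtain ⟨d, hd⟩ := exists_ncard_zerosIn hp ha hap hbp hI r j
    have hbdd : BddAbove (Set.range fun m : ℕ =>
        |((r + m * p : ℕ) : ℝ) / p - (zerosIn a b (r + m * p) (I j)).ncard|) := by
      refine IsBoundedUnder.bddAbove_range ⟨|(r : ℝ) / p + d|, ?_⟩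
      rw [eventually_map]
      filter_upwards [hd] with m hm
      have hm' : ((zerosIn a b (r + m * p) (I j)).ncard : ℝ) = m - d := by exact_mod_cast hm
      rw [hm']
      refine le_of_eq (congrArg _ ?_)
      push_cast
      field_simp
      ring
    obtain ⟨C, hC⟩ := hbdd
    exact ⟨C, fun m => hC ⟨m, rfl⟩⟩
  choose C hC using hclass
  obtain ⟨M, hM⟩ := (Set.finite_range C).bddAbove
  refine ⟨M, ?_⟩
  rintro _ ⟨⟨n, j⟩, rfl⟩
  have h := hC (⟨n % p, Nat.mod_lt _ hp⟩, j) (n / p)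
  simp only [Nat.mod_add_div'] at h
  exact h.trans (hM ⟨_, rfl⟩)

/-- Clock spacing along a residue class. -/
theorem exists_clock_residue (hp : 1 ≤ p) (ha : ∀ n, 0 < a n) (hap : ∀ n, a (n + p) = a n)
    (hbp : ∀ n, b (n + p) = b n)
    (hI : (∀ j : Fin p, I j = Icc (bandLeft a b p j) (bandRight a b p j)) ∨
      (∀ j : Fin p, I j = Ioo (bandLeft a b p j) (bandRight a b p j)))
    {r : ℕ} (hr : r < p) (j : Fin p) :
    ∃ K : ℝ, ∃ M : ℕ, ∀ m ≥ M, ∀ x y, Consecutive (zerosIn a b (r + m * p) (I j)) x y →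
      |equilibriumCDF a b p y - equilibriumCDF a b p x - 1 / ((r + m * p : ℕ) : ℝ)| ≤
        K / ((r + m * p : ℕ) : ℝ) ^ 2 := by
  obtain ⟨Y, hY⟩ := exists_bandParam (b := b) hp ha hap
  obtain ⟨K, hK, hev⟩ :=
    (isFloquetSequence_orthoPoly hp ha hap hbp r j).exists_spacing (hY j)
  obtain ⟨M, hM⟩ := eventually_atTop.1 hev
  have hpi := Real.pi_pos
  have hp0 : (0 : ℝ) < p := by exact_mod_cast hp
  refine ⟨2 * p * (Real.pi + 2 * K) / Real.pi, max M 1, fun m hm x y hxy => ?_⟩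
  have hIcc : I j ⊆ Icc (bandLeft a b p j) (bandRight a b p j) := by
    rcases hI with h | h
    · exact (h j).subset
    · exact (h j).subset.trans Ioo_subset_Icc_self
  have hord : (I j).OrdConnected := by
    rcases hI with h | h
    · rw [h j]; exact ordConnected_Icc
    · rw [h j]; exact ordConnected_Ioo
  obtain ⟨⟨hxI, hx0⟩, ⟨hyI, hy0⟩, hlt, hno⟩ := hxy
  obtain ⟨θ, hθ, rfl⟩ := (hY j).exists_eq (hIcc hxI)
  obtain ⟨θ', hθ', rfl⟩ := (hY j).exists_eq (hIcc hyI)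
  have hbetween : ∀ t, Y j t ∈ Ioo (Y j θ) (Y j θ') →
      (orthoPoly a b (r + m * p)).eval (Y j t) ≠ 0 := fun t ht h0 =>
    hno (Y j t) ⟨hord.out hxI hyI (Ioo_subset_Icc_self ht), h0⟩ ht
  rw [equilibriumCDF_sub hp ha hap hY j hθ hθ' hlt]
  set δ := |θ' - θ| with hδ
  have hm1 : (1 : ℝ) ≤ m := by exact_mod_cast (le_max_right M 1).trans hm
  have hm0 : (0 : ℝ) < m := by linarith
  -- the spacing in the angle, for either orientation of the band
  have hspace : |m * δ - Real.pi| ≤ K / m := by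
    rcases (hY j).strictMonoOn_or_strictAntiOn with hmono | hanti
    · have hθθ : θ < θ' := (hmono.lt_iff_lt hθ hθ').1 hlt
      rw [hδ, abs_of_pos (sub_pos.2 hθθ)]
      refine hM m ((le_max_left _ _).trans hm) θ hθ θ' hθ' hθθ hx0 hy0 fun t ht => hbetween t ?_
      have htI : t ∈ Icc 0 Real.pi := ⟨hθ.1.trans ht.1.le, ht.2.le.trans hθ'.2⟩
      exact ⟨hmono hθ htI ht.1, hmono htI hθ' ht.2⟩
    · have hθθ : θ' < θ := (hanti.lt_iff_gt hθ hθ').1 hlt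
      rw [hδ, abs_sub_comm θ' θ, abs_of_pos (sub_pos.2 hθθ)]
      refine hM m ((le_max_left _ _).trans hm) θ' hθ' θ hθ hθθ hy0 hx0 fun t ht => hbetween t ?_
      have htI : t ∈ Icc 0 Real.pi := ⟨hθ'.1.trans ht.1.le, ht.2.le.trans hθ.2⟩
      exact ⟨hanti htI hθ ht.2, hanti hθ' htI ht.1⟩
  have hδ0 : 0 ≤ δ := abs_nonneg _
  have hKm : K / m ≤ K := div_le_self hK hm1
  have hδm : m * δ ≤ Real.pi + K := by linarith [(abs_le.1 hspace).2]
  push_cast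
  set n : ℝ := r + m * p with hn
  have hr' : (r : ℝ) < p := by exact_mod_cast hr
  have hr0 : (0 : ℝ) ≤ r := Nat.cast_nonneg r
  have hmp : (p : ℝ) ≤ m * p := le_mul_of_one_le_left hp0.le hm1
  have hn0 : 0 < n := by positivity
  have hn2 : n ≤ 2 * p * m := by rw [hn]; linarith
  have hmain : |n * δ - p * Real.pi| * m ≤ p * (Real.pi + 2 * K) := by
    have h1 : n * δ - p * Real.pi = r * δ + p * (m * δ - Real.pi) := by rw [hn]; ring
    have h2 : |n * δ - p * Real.pi| ≤ r * δ + p * (K / m) := by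
      rw [h1]
      refine (abs_add_le _ _).trans ?_
      rw [abs_of_nonneg (mul_nonneg hr0 hδ0), abs_mul, abs_of_pos hp0]
      linarith [mul_le_mul_of_nonneg_left hspace hp0.le]
    have h3 : (r * δ + p * (K / m)) * m = r * (m * δ) + p * K := by field_simp
    have h4 := mul_le_mul_of_nonneg_right h2 hm0.le
    have h5 : r * (m * δ) ≤ p * (Real.pi + K) :=
      mul_le_mul hr'.le hδm (by positivity) hp0.le
    linarith
  have hdiff : δ / (p * Real.pi) - 1 / n = (n * δ - p * Real.pi) / (p * Real.pi * n) := by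
    field_simp
  rw [hdiff, abs_div, abs_of_pos (by positivity : 0 < p * Real.pi * n), div_le_div_iff₀
    (by positivity) (by positivity)]
  have h6 : |n * δ - p * Real.pi| * n ≤ 2 * p * (p * (Real.pi + 2 * K)) := by
    calc |n * δ - p * Real.pi| * n ≤ |n * δ - p * Real.pi| * (2 * p * m) :=
          mul_le_mul_of_nonneg_left hn2 (abs_nonneg _)
      _ = 2 * p * (|n * δ - p * Real.pi| * m) := by ring
      _ ≤ _ := mul_le_mul_of_nonneg_left hmain (by positivity)
  calc |n * δ - p * Real.pi| * n ^ 2 = (|n * δ - p * Real.pi| * n) * n := by ring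
    _ ≤ 2 * p * (p * (Real.pi + 2 * K)) * n := mul_le_mul_of_nonneg_right h6 hn0.le
    _ = 2 * p * (Real.pi + 2 * K) / Real.pi * (p * Real.pi * n) := by field_simp

theorem abs_equilibriumCDF_sub_le (hp : 1 ≤ p) (ha : ∀ n, 0 < a n) (hap : ∀ n, a (n + p) = a n)
    (x y : ℝ) : |equilibriumCDF a b p y - equilibriumCDF a b p x| ≤ 1 := by
  obtain ⟨Y, hY⟩ := exists_bandParam (b := b) hp ha hap
  have := isProbabilityMeasure_bandMeasure hp fun j => (hY j).continuous
  have h : ∀ z, 0 ≤ equilibriumCDF a b p z ∧ equilibriumCDF a b p z ≤ 1 := by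
    intro z
    rw [equilibriumCDF, equilibriumMeasure_bands hp ha hap hY]
    exact ⟨MeasureTheory.measureReal_nonneg, MeasureTheory.measureReal_le_one⟩
  rw [abs_le]
  constructor <;> linarith [(h x).1, (h x).2, (h y).1, (h y).2]

/-- Clock spacing of the zeros in the bands, with error `O(1 / n²)`. -/
theorem exists_clock (hp : 1 ≤ p) (ha : ∀ n, 0 < a n) (hap : ∀ n, a (n + p) = a n)
    (hbp : ∀ n, b (n + p) = b n)
    (hI : (∀ j : Fin p, I j = Icc (bandLeft a b p j) (bandRight a b p j)) ∨
      (∀ j : Fin p, I j = Ioo (bandLeft a b p j) (bandRight a b p j))) :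
    ∃ K : ℝ, ∀ n : ℕ, 1 ≤ n → ∀ (j : Fin p) (x y : ℝ), Consecutive (zerosIn a b n (I j)) x y →
      |equilibriumCDF a b p y - equilibriumCDF a b p x - 1 / (n : ℝ)| ≤ K / (n : ℝ) ^ 2 := by
  choose K M hKM using fun rj : Fin p × Fin p =>
    exists_clock_residue hp ha hap hbp hI rj.1.2 rj.2
  obtain ⟨K', hK'⟩ := (Set.finite_range K).bddAbove
  obtain ⟨M', hM'⟩ := (Set.finite_range M).bddAbove
  -- the trivial bound `2` covers the finitely many small values of `n`
  refine ⟨max K' (2 * (M' * p : ℕ) ^ 2), fun n hn j x y hxy => ?_⟩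
  have hn1 : (1 : ℝ) ≤ n := by exact_mod_cast hn
  have hn2 : (0 : ℝ) < (n : ℝ) ^ 2 := by positivity
  by_cases hlarge : M' ≤ n / p
  · have h := hKM (⟨n % p, Nat.mod_lt _ hp⟩, j) (n / p) ((hM' ⟨_, rfl⟩).trans hlarge) x y
    simp only [Nat.mod_add_div'] at h
    exact (h hxy).trans (div_le_div_of_nonneg_right
      ((hK' ⟨_, rfl⟩).trans (le_max_left _ _)) hn2.le)
  · have hlt : n < M' * p := (Nat.div_lt_iff_lt_mul hp).1 (not_le.1 hlarge)
    have hlt' : (n : ℝ) ≤ (M' * p : ℕ) := by exact_mod_cast hlt.le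
    have h1 := abs_equilibriumCDF_sub_le (b := b) hp ha hap x y
    have h2 : |1 / (n : ℝ)| ≤ 1 := by
      rw [abs_of_pos (by positivity)]
      exact div_le_one_of_le₀ hn1 (by positivity)
    have h3 : |equilibriumCDF a b p y - equilibriumCDF a b p x - 1 / (n : ℝ)| ≤ 2 :=
      (abs_sub _ _).trans (by linarith)
    refine h3.trans ?_
    rw [le_div_iff₀ hn2]
    refine le_trans ?_ (le_max_right _ _)
    exact mul_le_mul_of_nonneg_left (pow_le_pow_left₀ (by positivity) hlt' 2) (by norm_num)

end Clock

end PeriodicJacobi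

end

theorem theorem2p5 (p : ℕ) (hp : 1 ≤ p) (a b : ℕ → ℝ)
    (ha : ∀ n, 0 < a n) (hap : ∀ n, a (n + p) = a n) (hbp : ∀ n, b (n + p) = b n)
    -- the bands, either all taken with their edges or all taken without their edges
    (I : Fin p → Set ℝ)
    (hI : (∀ j : Fin p, I j =
            Set.Icc (PeriodicJacobi.bandLeft a b p j) (PeriodicJacobi.bandRight a b p j)) ∨
          (∀ j : Fin p, I j =
            Set.Ioo (PeriodicJacobi.bandLeft a b p j) (PeriodicJacobi.bandRight a b p j))) :
    -- the number of zeros of `p_{mp+r-1}` in a band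
    (∀ (r : ℕ) (j : Fin p), ∃ D : ℤ, ∀ᶠ m : ℕ in Filter.atTop,
      ((PeriodicJacobi.zerosIn a b (m * p + r - 1) (I j)).ncard : ℤ) = (m : ℤ) - D ∨
      ((PeriodicJacobi.zerosIn a b (m * p + r - 1) (I j)).ncard : ℤ) = (m : ℤ) - D + 1) ∧
    -- `sup_{n,j} |n/p - N^{(n,j)}| < ∞`
    BddAbove (Set.range fun q : ℕ × Fin p =>
      |(q.1 : ℝ) / (p : ℝ) - ((PeriodicJacobi.zerosIn a b q.1 (I q.2)).ncard : ℝ)|) ∧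
    -- clock behavior, uniformly over the bands and the pairs of consecutive zeros in a band
    (∀ ε : ℝ, 0 < ε → ∃ n₀ : ℕ, ∀ n : ℕ, n₀ ≤ n → ∀ (j : Fin p) (x y : ℝ),
      PeriodicJacobi.Consecutive (PeriodicJacobi.zerosIn a b n (I j)) x y →
      (n : ℝ) * |PeriodicJacobi.equilibriumCDF a b p y -
        PeriodicJacobi.equilibriumCDF a b p x - 1 / (n : ℝ)| ≤ ε) ∧
    -- clock behavior with the error term `O(1/n^2)`
    (∃ K : ℝ, ∀ n : ℕ, 1 ≤ n → ∀ (j : Fin p) (x y : ℝ),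
      PeriodicJacobi.Consecutive (PeriodicJacobi.zerosIn a b n (I j)) x y →
      |PeriodicJacobi.equilibriumCDF a b p y -
        PeriodicJacobi.equilibriumCDF a b p x - 1 / (n : ℝ)| ≤ K / (n : ℝ) ^ 2) := by
  obtain ⟨K, hK⟩ := PeriodicJacobi.exists_clock hp ha hap hbp hI
  refine ⟨fun r j => ?_, PeriodicJacobi.bddAbove_ncard_zerosIn hp ha hap hbp hI, ?_, K, hK⟩
  · rcases Nat.eq_zero_or_pos r with rfl | hr
    · -- `mp - 1 = (p - 1) + (m - 1) p`
      obtain ⟨d, hd⟩ := PeriodicJacobi.exists_ncard_zerosIn hp ha hap hbp hI (p - 1) j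
      refine ⟨d + 1, ?_⟩
      filter_upwards [(Filter.tendsto_sub_atTop_nat 1).eventually hd,
        Filter.eventually_ge_atTop 1] with m hm hm1
      obtain ⟨k, rfl⟩ : ∃ k, m = k + 1 := ⟨m - 1, by omega⟩
      rw [Nat.add_sub_cancel] at hm
      rw [show (k + 1) * p + 0 - 1 = p - 1 + k * p by rw [add_mul]; omega, hm]
      left
      push_cast
      ring
    · obtain ⟨d, hd⟩ := PeriodicJacobi.exists_ncard_zerosIn hp ha hap hbp hI (r - 1) j
      refine ⟨d, hd.mono fun m hm => Or.inl ?_⟩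
      rw [show m * p + r - 1 = r - 1 + m * p by omega, hm]
  · intro ε hε
    refine ⟨max 1 ⌈K / ε⌉₊, fun n hn j x y hxy => ?_⟩
    have hn1 : 1 ≤ n := (le_max_left _ _).trans hn
    have hn0 : (0 : ℝ) < n := by exact_mod_cast hn1
    have hKn : K / ε ≤ n := (Nat.le_ceil _).trans (by exact_mod_cast (le_max_right _ _).trans hn)
    calc (n : ℝ) * |PeriodicJacobi.equilibriumCDF a b p y -
          PeriodicJacobi.equilibriumCDF a b p x - 1 / (n : ℝ)|
        ≤ n * (K / (n : ℝ) ^ 2) := mul_le_mul_of_nonneg_left (hK n hn1 j x y hxy) hn0.le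
      _ = K / n := by field_simp
      _ ≤ ε := by rwa [div_le_iff₀ hn0, mul_comm, ← div_le_iff₀ hε]
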